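/- **Setting.** Let $M\ge 1$, $\lambda>0$, $\tilde{\mathcal U}>0$, $\eta>2$, $\theta>0$, $\sigma\in\mathbb R$, $0<\rho_1<\dots<\rho_M$, $c=3.575$, and let $\mathbf x=(\mathbf x^{[1]},\dots,\mathbf x^{[M]})$ be a probability vector, where $\mathbf x^{[k]}$ is the fraction of devices using power control threshold $\rho_k$. Put $\tilde{\mathcal U}_k=\mathbf x^{[k]}\tilde{\mathcal U}$. Consider the following (approximate) network model, seen by a test device whose base station is at the origin of $\mathbb R^2$. The test device is in power level $S$ with $\mathbb P\{S=m\}=\mathbf x^{[m]}$ and has channel gain $h$. For each level $k$: (i) there are $N_k$ further contending devices in the cell, where $N_k$ is Poisson with mean $\tilde{\mathcal U}_kA$ given the cell area $A$, and $A$ is Gamma distributed with shape $c$ and rate $c\lambda$; their interference is $\mathcal I^{(k)}_{Intra}=\sum_{n\le N_k}\rho_k g_{k,n}$ with channel gains $g_{k,n}$; (ii) the out-of-cell devices are the points $u_{k,i}$ of a homogeneous Poisson point process of intensity $\tilde{\mathcal U}_k$; the device $u_{k,i}$ transmits with power $P_{k,i}=\rho_k r_{k,i}^{\eta}$ (full path-loss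 inversion), where $r_{k,i}$ has the law of the distance from the origin to the nearest point of a homogeneous Poisson point process of base stations of intensity $\lambda$; their interference is $\mathcal I^{(k)}_{Inter}=\sum_i \mathbf 1\{P_{k,i}\|u_{k,i}\|^{-\eta}<\rho_k\}\,P_{k,i}h_{k,i}\|u_{k,i}\|^{-\eta}$ with channel gains $h_{k,i}$. All channel gains are exponential with mean $1$, and the variables $S,h,N_k,g_{k,n},r_{k,i},h_{k,i}$ and the Poisson processes of devices are all independent. Let $$p_m=\mathbb P\{\Upsilon_m<\theta\},\qquad \Upsilon_m=\frac{\rho_m h}{\sigma^2+\sum_k \mathcal I^{(k)}_{Intra}+\sum_k\mathcal I^{(k)}_{Inter}},$$ and let $p=\mathbb P\{\Upsilon_S<\theta\}$ be the average failure probability of the test device. The ramping DTMC with failure probabilities $(p_1,\dots,p_M)$ is the Markov chain on $\{1,\dots,M\}$ that moves from $i$ to $1$ with probability $1-p_i$ and to $\min(i+1,M)$ with probability $p_i$; let $\mathbf P$ be its transition matrix. Its stationary equations are $\mathbf x\mathbf P=\mathbf x$, $\sum_m\mathbf x^{[m]}=1$. For a probability vector $\mathbf x$ put $\mathcal P_k=\frac{c\lambda}{c\lambda+\tilde{\mathcal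 U}_k}$, $t_{m,k}=\theta\rho_k/\rho_m$ and $$F_m(\mathbf x)=1-e^{-\sigma^2\theta/\rho_m}\prod_{k=1}^M\left(\frac{\mathcal P_k(1+t_{m,k})}{\mathcal P_k+t_{m,k}}\right)^{c}\exp\left\{-\frac{2\tilde{\mathcal U}_k}{\lambda(\eta-2)}\,t_{m,k}\;{}_2F_1\!\left(1,1-\tfrac2\eta;2-\tfrac2\eta;-t_{m,k}\right)\right\},$$ where ${}_2F_1$ is the Gauss hypergeometric function. A *steady state* is a probability vector $\mathbf x$ that solves the stationary equations of the ramping DTMC with failure probabilities $F_1(\mathbf x),\dots,F_M(\mathbf x)$. **Theorem.** (a) For every probability vector $\mathbf x$ (in particular every steady state) the model satisfies $p_m=F_m(\mathbf x)$ for all $m$, $\mathbb P\{\Upsilon_S<\theta\mid S=m\}=F_m(\mathbf x)$ whenever $\mathbf x^{[m]}>0$, and $p=\sum_{m=1}^M\mathbf x^{[m]}p_m=\sum_{m=1}^M\mathbf x^{[m]}F_m(\mathbf x)$. Moreover $\mathbf x$ solves the stationary equations of the ramping DTMC with failure probabilities $p_1,\dots,p_M$ if and only if $\mathbf x$ is a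 steady state. (b) If $\eta=4$, then $F_m(\mathbf x)=1-e^{-\sigma^2\theta/\rho_m}\prod_{k=1}^M\left(\frac{\mathcal P_k(1+t_{m,k})}{\mathcal P_k+t_{m,k}}\right)^{c}\exp\left\{-\frac{\tilde{\mathcal U}_k}{\lambda}\sqrt{t_{m,k}}\,\arctan\sqrt{t_{m,k}}\right\}$. (c) Consider the iteration that starts at a probability vector $\mathbf x(0)$ and, for $i\ge1$, computes the failure probabilities $F_m(\mathbf x(i-1))$, inserts them in $\mathbf P$, takes for $\mathbf x(i)$ the solution of the stationary equations, and returns $\mathbf x(i)$ at the first $i\ge 1$ with $\max_k|\mathbf x^{[k]}(i)-\mathbf x^{[k]}(i-1)|<\epsilon$. It is well defined: for every probability vector $\mathbf x$ we have $0<F_m(\mathbf x)<1$, the stationary equations with failure probabilities $F_m(\mathbf x)$ have exactly one solution, and this solution is a probability vector with positive entries; so the sequence of iterates exists and is unique. If the iterates converge, their limit is a steady state. For every $\delta>0$ there is $\epsilon_0>0$ such that, for every tolerance $0<\epsilon\le\epsilon_0$ and every initial probability vector, if the iteration returns a vector $\mathbf y$, then there is a steady state $\mathbf x$ with $\max_k|\mathbf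 y^{[k]}-\mathbf x^{[k]}|<\delta$. -/

import Mathlib

open MeasureTheory ProbabilityTheory
open scoped ENNReal NNReal

noncomputable section

/-! ### Gauss hypergeometric function -/

/-- The Gauss hypergeometric function `₂F₁(a, b; c; z)` for `c > b > 0` and real `z < 1`, on the
whole half-line, by Euler's integral. (The power series, Mathlib's `ordinaryHypergeometric`, only
converges for `|z| < 1`; here arguments `z ≤ -1` occur as well.) -/
def gaussHypergeometric (a b c z : ℝ) : ℝ :=
  Real.Gamma c / (Real.Gamma b * Real.Gamma (c - b)) *
    ∫ u in (0 : ℝ)..1, u ^ (b - 1) * (1 - u) ^ (c - b - 1) * (1 - z * u) ^ (-a)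

theorem gaussHypergeometric_hasSum (b z : ℝ) (hb : 0 < b) (hz : |z| < 1) :
    HasSum (fun n : ℕ => b / (b + n) * z ^ n) (gaussHypergeometric 1 b (b + 1) z) := by
  have h1 : gaussHypergeometric 1 b (b+1) z = b * ∫ u in Set.Ioc (0:ℝ) 1, u^(b-1) * (1 - z*u)⁻¹ := by
    unfold gaussHypergeometric
    rw [intervalIntegral.integral_of_le zero_le_one, Real.Gamma_add_one hb.ne']
    have := (Real.Gamma_pos_of_pos hb).ne'
    congr 1
    · simp; field_simp
    · simp [Real.rpow_neg_one]
  rw [h1]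
  have hint : ∀ n : ℕ, IntegrableOn (fun u : ℝ => u^(b-1+n)) (Set.Ioc 0 1) := fun n => by
    have h0 : (0:ℝ) ≤ n := by positivity
    have := intervalIntegral.intervalIntegrable_rpow' (a := 0) (b := 1) (r := b-1+n) (by linarith)
    exact (intervalIntegrable_iff_integrableOn_Ioc_of_le zero_le_one).1 this
  have hval : ∀ n : ℕ, ∫ u in Set.Ioc (0:ℝ) 1, u^(b-1+n) = 1/(b+n) := fun n => by
    have hn : (0:ℝ) ≤ n := by positivity
    rw [← intervalIntegral.integral_of_le zero_le_one, integral_rpow (Or.inl (by linarith))]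
    rw [Real.zero_rpow (by linarith), Real.one_rpow]; ring_nf
  have key := hasSum_integral_of_summable_integral_norm (μ := volume.restrict (Set.Ioc (0:ℝ) 1))
    (F := fun (n : ℕ) u => z^n * u^(b-1+n)) (fun n => (hint n).const_mul _) ?_
  · have : ∫ u in Set.Ioc (0:ℝ) 1, ∑' n : ℕ, z^n * u^(b-1+n) = ∫ u in Set.Ioc (0:ℝ) 1, u^(b-1) * (1 - z*u)⁻¹ := by
      refine setIntegral_congr_fun measurableSet_Ioc fun u hu => ?_
      have hzu : |z*u| < 1 := by
        rw [abs_mul, abs_of_pos hu.1]; nlinarith [hu.1, hu.2, abs_nonneg z]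
      rw [← tsum_geometric_of_abs_lt_one hzu, ← tsum_mul_left]
      refine tsum_congr fun n => ?_
      rw [Real.rpow_add hu.1, Real.rpow_natCast]; ring
    rw [this] at key
    have h4 : (fun n : ℕ => b / (b + n) * z ^ n) = fun n : ℕ => b * ∫ u in Set.Ioc (0:ℝ) 1, z^n * u^(b-1+n) := by
      funext n; rw [integral_const_mul, hval]; ring
    rw [h4]; exact key.mul_left b
  · have : ∀ n : ℕ, ∫ u in Set.Ioc (0:ℝ) 1, ‖z^n * u^(b-1+n)‖ = |z|^n * (1/(b+n)) := fun n => by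
      rw [← hval, ← integral_const_mul]
      refine setIntegral_congr_fun measurableSet_Ioc fun u hu => ?_
      simp only [norm_mul, norm_pow, Real.norm_eq_abs, abs_of_pos (Real.rpow_pos_of_pos hu.1 _)]
    simp_rw [this]
    refine Summable.of_nonneg_of_le (fun n => by positivity) (fun n => ?_) ((summable_geometric_of_lt_one (abs_nonneg z) hz).mul_right (1/b))
    gcongr; simp

/-- In the unit disc the integral agrees with the hypergeometric series, for the parameters used
here (`a = 1`, `c = b + 1`). -/
theorem gaussHypergeometric_eq_series (b z : ℝ) (hb : 0 < b) (hz : |z| < 1) :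
    gaussHypergeometric 1 b (b + 1) z = ordinaryHypergeometric 1 b (b + 1) z := by
  rw [← (gaussHypergeometric_hasSum b z hb hz).tsum_eq, ordinaryHypergeometric, ordinaryHypergeometric_sum_eq]
  refine tsum_congr fun n => ?_
  have h2 : ∀ n : ℕ, (ascPochhammer ℝ n).eval (b+1) * b = (ascPochhammer ℝ n).eval b * (b+n) := by
    intro n
    have h := ascPochhammer_succ_eval (S := ℝ) n b
    have h' : (ascPochhammer ℝ (n+1)).eval b = b * (ascPochhammer ℝ n).eval (b+1) := by
      rw [ascPochhammer_succ_left]; simp [Polynomial.eval_comp]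
    linarith
  have p1 := ascPochhammer_pos (S := ℝ) n (b+1) (by linarith)
  have : 0 < b + n := by positivity
  have h3 := h2 n
  rw [ascPochhammer_eval_one]
  have : (n.factorial : ℝ) ≠ 0 := by positivity
  simp only [smul_eq_mul]
  field_simp
  linear_combination z ^ n * h3

/-! ### Point processes in the plane -/

/-- The plane `ℝ²` with its Euclidean norm and Lebesgue measure. -/
abbrev Plane : Type := EuclideanSpace ℝ (Fin 2)

/-- An enumerated point process `{pt i : i < num}` in the plane, with a random, possibly infinite,
number `num` of points. -/
structure PointProcess (Ω : Type*) [MeasurableSpace Ω] where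
  num : Ω → ℕ∞
  pt : ℕ → Ω → Plane
  measurable_num : Measurable num
  measurable_pt : ∀ i, Measurable (pt i)

namespace PointProcess

variable {Ω : Type*} [MeasurableSpace Ω]

/-- The number of points in `B`. -/
def count (Φ : PointProcess Ω) (B : Set Plane) (ω : Ω) : ℕ∞ :=
  Set.encard {i : ℕ | (i : ℕ∞) < Φ.num ω ∧ Φ.pt i ω ∈ B}

/-- Homogeneous Poisson point process of intensity `lam`: the number of points in a Borel set `B` of
finite area is Poisson with mean `lam * |B|`, and the numbers of points in pairwise disjoint Borel
sets are independent. -/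
structure IsPoisson (Φ : PointProcess Ω) (lam : ℝ) (P : Measure Ω) : Prop where
  law_count : ∀ B : Set Plane, MeasurableSet B → volume B ≠ ∞ → ∀ n : ℕ,
    P {ω | Φ.count B ω = n} = poissonMeasure (ENNReal.ofReal lam * volume B).toNNReal {n}
  indep_count : ∀ (n : ℕ) (B : Fin n → Set Plane), (∀ j, MeasurableSet (B j)) →
    Pairwise (fun i j => Disjoint (B i) (B j)) → iIndepFun (fun j => Φ.count (B j)) P

/-- Distance from the origin to the nearest point of the process. -/
def distToOrigin (Φ : PointProcess Ω) (ω : Ω) : ℝ :=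
  Metric.infDist (0 : Plane) {y | ∃ i : ℕ, (i : ℕ∞) < Φ.num ω ∧ Φ.pt i ω = y}

end PointProcess

/-! ### Parameters of the power ramping scheme -/

/-- The shape parameter `c = 3.575` of the Gamma approximation of the area of a planar
Poisson--Voronoi cell. -/
def voronoiShape : ℝ := 3.575

/-- The parameters of the network: intensity `lam` of base stations, intensity `U` of devices
that contend on the same sequence (over all power states), path-loss exponent `eta`, detection
threshold `theta`, noise power `sigma ^ 2`, and power control thresholds `rho`. -/
structure RampingParams (M : ℕ) where
  lam : ℝ
  U : ℝ
  eta : ℝ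
  theta : ℝ
  sigma : ℝ
  rho : Fin M → ℝ
  lam_pos : 0 < lam
  U_pos : 0 < U
  two_lt_eta : 2 < eta
  theta_pos : 0 < theta
  rho_pos : ∀ m, 0 < rho m
  rho_strictMono : StrictMono rho

namespace RampingParams

variable {M : ℕ} (q : RampingParams M)

/-- The intensity of the devices that transmit with power control threshold `rho k`. -/
def activeIntensity (x : Fin M → ℝ) (k : Fin M) : ℝ := x k * q.U

/-- `𝒫_k = c λ / (c λ + Ũ_k)`. -/
def cellParam (x : Fin M → ℝ) (k : Fin M) : ℝ :=
  voronoiShape * q.lam / (voronoiShape * q.lam + q.activeIntensity x k)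

/-- `θ ρ_k / ρ_m`. -/
def relThreshold (m k : Fin M) : ℝ := q.theta * q.rho k / q.rho m

/-- The intra-cell factor of power level `k`. -/
def intraFactor (x : Fin M → ℝ) (m k : Fin M) : ℝ :=
  (q.cellParam x k * (1 + q.relThreshold m k) / (q.cellParam x k + q.relThreshold m k))
    ^ voronoiShape

/-- The inter-cell factor of power level `k`. -/
def interFactor (x : Fin M → ℝ) (m k : Fin M) : ℝ :=
  Real.exp (-(2 * q.activeIntensity x k / (q.lam * (q.eta - 2)) * q.relThreshold m k *
    gaussHypergeometric 1 (1 - 2 / q.eta) (2 - 2 / q.eta) (-q.relThreshold m k)))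

/-- The closed-form failure probability at power level `m`. -/
def failProb (x : Fin M → ℝ) (m : Fin M) : ℝ :=
  1 - Real.exp (-(q.sigma ^ 2 * q.theta / q.rho m)) *
    ∏ k, q.intraFactor x m k * q.interFactor x m k

end RampingParams

/-! ### The ramping Markov chain and the iterative algorithm -/

/-- Transition matrix of the ramping chain: from power level `i`, a success (probability
`1 - p i`) leads to the first level, a failure (probability `p i`) to the next level, the last level
being kept after a failure. -/
def rampMatrix {M : ℕ} (p : Fin M → ℝ) : Matrix (Fin M) (Fin M) ℝ := fun i j =>
  (if (j : ℕ) = 0 then 1 - p i else 0) + (if (j : ℕ) = min ((i : ℕ) + 1) (M - 1) then p i else 0)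

/-- The stationary equations `x P = x`, `∑ x = 1` of the ramping chain with failure
probabilities `p`. -/
def SolvesStationary {M : ℕ} (p x : Fin M → ℝ) : Prop :=
  Matrix.vecMul x (rampMatrix p) = x ∧ ∑ m, x m = 1

namespace RampingParams

variable {M : ℕ} (q : RampingParams M)

/-- A steady state of the coupled system: a probability vector that is stationary for the
ramping chain whose failure probabilities are computed from that same vector. -/
def IsSteadyState (x : Fin M → ℝ) : Prop :=
  x ∈ stdSimplex ℝ (Fin M) ∧ SolvesStationary (q.failProb x) x

/-- The iterates `x(0), x(1), …` of the algorithm from `x₀`: at each round the failure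
probabilities are computed from the previous vector, the transition matrix is updated, and the
stationary equations are solved for the new vector. -/
def IsRun (x₀ : Fin M → ℝ) (x : ℕ → Fin M → ℝ) : Prop :=
  x 0 = x₀ ∧ ∀ i, SolvesStationary (q.failProb (x i)) (x (i + 1))

/-- The algorithm with tolerance `ε`, started at `x₀`, terminates and returns `y`: the loop ends
at the first round in which no entry changes by `ε` or more. -/
def Returns (ε : ℝ) (x₀ y : Fin M → ℝ) : Prop :=
  ∃ x : ℕ → Fin M → ℝ, q.IsRun x₀ x ∧ ∃ i : ℕ,
    (∀ j < i, ∃ k, ε ≤ |x (j + 1) k - x j k|) ∧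
    (∀ k, |x (i + 1) k - x i k| < ε) ∧ y = x (i + 1)

end RampingParams

/-! ### The network model -/

/-- The law of the number of contending devices in a cell: Poisson with mean `u * A` given the cell
area `A`, where `A` has the Gamma law with shape `c` and rate `c * lam` (hence mean `1 / lam`). -/
def cellCountLaw (lam u : ℝ) : Measure ℕ :=
  (gammaMeasure voronoiShape (voronoiShape * lam)).bind
    (fun A => poissonMeasure (u * A).toNNReal)

/-- The sources of randomness of the network. -/
inductive Source (M : ℕ) : Type
  | state
  | gain
  | cellCount (k : Fin M)
  | intraGain (k : Fin M) (n : ℕ)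
  | devices (k : Fin M)
  | servDist (k : Fin M) (i : ℕ)
  | interGain (k : Fin M) (i : ℕ)

/-- The network seen by a test device whose serving base station is at the origin, when the fraction
of devices in power level `k` is `x k`.

The device is in level `state`, with law `x`, and has channel gain `gain`. For each level `k`,
there are `cellCount k` other contending devices in the cell, with gains `intraGain k n`; the
out-of-cell devices form a Poisson point process `devices k` of intensity `x k * U`, the `i`-th of
which is at distance `servDist k i` from its own base station and has gain `interGain k i` towards
the origin. The distances `servDist k i` have the law of the distance from a typical location to
the nearest point of a Poisson point process of base stations. All channel gains are exponential
with mean one, and all the sources of randomness are independent. -/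
structure RampingNetwork {M : ℕ} (q : RampingParams M) (x : Fin M → ℝ)
    {Ω : Type*} [MeasurableSpace Ω] (P : Measure Ω) where
  state : Ω → Fin M
  gain : Ω → ℝ
  cellCount : Fin M → Ω → ℕ
  intraGain : Fin M → ℕ → Ω → ℝ
  devices : Fin M → PointProcess Ω
  servDist : Fin M → ℕ → Ω → ℝ
  interGain : Fin M → ℕ → Ω → ℝ
  stations : PointProcess Ω
  measurable_state : Measurable state
  measurable_gain : Measurable gain
  measurable_cellCount : ∀ k, Measurable (cellCount k)
  measurable_intraGain : ∀ k n, Measurable (intraGain k n)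
  measurable_servDist : ∀ k i, Measurable (servDist k i)
  measurable_interGain : ∀ k i, Measurable (interGain k i)
  law_state : ∀ m, P {ω | state ω = m} = ENNReal.ofReal (x m)
  law_gain : P.map gain = expMeasure 1
  law_cellCount : ∀ k, P.map (cellCount k) = cellCountLaw q.lam (q.activeIntensity x k)
  law_intraGain : ∀ k n, P.map (intraGain k n) = expMeasure 1
  law_devices : ∀ k, (devices k).IsPoisson (q.activeIntensity x k) P
  law_stations : stations.IsPoisson q.lam P
  law_servDist : ∀ k i, IdentDistrib (servDist k i) stations.distToOrigin P P
  law_interGain : ∀ k i, P.map (interGain k i) = expMeasure 1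
  indep : iIndep (fun s : Source M => match s with
    | .state => MeasurableSpace.comap state inferInstance
    | .gain => MeasurableSpace.comap gain inferInstance
    | .cellCount k => MeasurableSpace.comap (cellCount k) inferInstance
    | .intraGain k n => MeasurableSpace.comap (intraGain k n) inferInstance
    | .devices k => MeasurableSpace.comap
        (fun ω => ((devices k).num ω, fun i => (devices k).pt i ω)) inferInstance
    | .servDist k i => MeasurableSpace.comap (servDist k i) inferInstance
    | .interGain k i => MeasurableSpace.comap (interGain k i) inferInstance) P

namespace RampingNetwork

variable {M : ℕ} {q : RampingParams M} {x : Fin M → ℝ} {Ω : Type*} [MeasurableSpace Ω]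
  {P : Measure Ω} (N : RampingNetwork q x P)

/-- Full path-loss inversion: the transmit power with which the average power received at the own
base station equals `rho k`. -/
def power (k : Fin M) (i : ℕ) (ω : Ω) : ℝ := q.rho k * N.servDist k i ω ^ q.eta

/-- Intra-cell interference from level `k`. -/
def intraInterference (k : Fin M) (ω : Ω) : ℝ≥0∞ :=
  ∑ n ∈ Finset.range (N.cellCount k ω), ENNReal.ofReal (q.rho k * N.intraGain k n ω)

open Classical in
/-- Inter-cell interference from level `k`: by nearest-station association, only devices
whose average received power at the origin is less than `rho k` contribute. -/
def interInterference (k : Fin M) (ω : Ω) : ℝ≥0∞ :=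
  ∑' i : ℕ, if (i : ℕ∞) < (N.devices k).num ω ∧
      N.power k i ω * ‖(N.devices k).pt i ω‖ ^ (-q.eta) < q.rho k then
    ENNReal.ofReal (N.power k i ω * N.interGain k i ω * ‖(N.devices k).pt i ω‖ ^ (-q.eta))
  else 0

/-- The SINR of the test device when it uses power control threshold `rho m`. -/
def sinr (m : Fin M) (ω : Ω) : ℝ≥0∞ :=
  ENNReal.ofReal (q.rho m * N.gain ω) /
    (ENNReal.ofReal (q.sigma ^ 2) + ∑ k, N.intraInterference k ω + ∑ k, N.interInterference k ω)

/-- Transmission failure with power control threshold `rho m`. -/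
def failAt (m : Fin M) : Set Ω := {ω | N.sinr m ω < ENNReal.ofReal q.theta}

/-- Transmission failure of the test device, whose power level is random. -/
def fail : Set Ω := {ω | N.sinr (N.state ω) ω < ENNReal.ofReal q.theta}

end RampingNetwork

end

/-! Because the gain of the test device is exponential with mean one, success at level `m` given
noise plus interference `I` has probability exp(-θI/ρ_m). Hence 1 - p_m is the Laplace transform of
`I` at θ/ρ_m (`measure_le_div_of_exp`). The 2M interference components draw on disjoint groups of
independent sources, so this transform is the noise term times 2M separate factors
(`lintegral_prod_of_iIndep`).

Intra-cell factor: given the cell area, the Poisson generating function leaves an exponential in the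
area, and averaging it is a Laplace transform of the Gamma law (`lintegral_pow_cellCountLaw`).
Inter-cell factor: the Laplace functional of a Poisson process with independent marks gives exp(-Ũ_k
∫(1 - g(y)) dy), where g(y) is the factor of a device at y averaged over its mark. For a serving
distance r, nearest-station association means ‖y‖ > r, and ‖y‖ = r v^(-1/η) turns the integral over
y into r² times an Euler integral (`lintegral_interference`). So the law of r enters only through E
r² = 1/(λπ), which cancels the π from polar coordinates. For η = 4 the Euler integral is an
arctangent.

The transforms are computed in [0, ∞] with `expNeg`, which is continuous also at ∞, so almost sure
finiteness of the interference never has to be proved. The failure event at a fixed level does not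
involve the state S; conditioning on S and total probability follow.

In the ramping chain a level above the first is entered only by a failure at the preceding level, or
at the last level by a failure there. The stationary equations are thus a first-order recursion, and
normalisation picks one positive solution (`solvesStationary_iff`). One round of the algorithm has a
closed graph in a compact square, and steady states are its diagonal points (`isClosed_roundGraph`).
Limits of iterates therefore lie on the diagonal, and among the graph points far from every steady
state the displacement has a positive minimum, which serves as the tolerance. -/

noncomputable section

/-! ### The function `a ↦ exp (-a)` on `[0, ∞]` -/

/-- `a ↦ exp (-a)` on `[0, ∞]`, with value `0` at `∞`. -/
def expNeg (a : ℝ≥0∞) : ℝ≥0∞ := EReal.exp (-(a : EReal))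

theorem expNeg_zero : expNeg 0 = 1 := by simp [expNeg]

theorem expNeg_top : expNeg ∞ = 0 := by simp [expNeg]

theorem expNeg_ofReal {a : ℝ} (ha : 0 ≤ a) :
    expNeg (ENNReal.ofReal a) = ENNReal.ofReal (Real.exp (-a)) := by
  simp [expNeg, ha, ← EReal.coe_neg]

theorem expNeg_add (a b : ℝ≥0∞) : expNeg (a + b) = expNeg a * expNeg b := by
  simp only [expNeg]
  rw [EReal.coe_ennreal_add, EReal.neg_add (by simp) (by simp), sub_eq_add_neg, EReal.exp_add]

theorem expNeg_sum {ι : Type*} (J : Finset ι) (f : ι → ℝ≥0∞) :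
    expNeg (∑ j ∈ J, f j) = ∏ j ∈ J, expNeg (f j) := by
  classical
  induction J using Finset.induction_on with
  | empty => simp [expNeg_zero]
  | insert a J ha ih => rw [Finset.sum_insert ha, Finset.prod_insert ha, expNeg_add, ih]

theorem expNeg_nsmul (n : ℕ) (a : ℝ≥0∞) : expNeg (n * a) = expNeg a ^ n := by
  have := expNeg_sum (Finset.range n) (fun _ => a)
  simpa using this

theorem continuous_expNeg : Continuous expNeg :=
  ENNReal.continuous_exp.comp (continuous_neg.comp continuous_coe_ennreal_ereal)

theorem measurable_expNeg : Measurable expNeg := continuous_expNeg.measurable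

theorem antitone_expNeg : Antitone expNeg := fun a b h =>
  EReal.exp_monotone (EReal.neg_le_neg_iff.2 (by exact_mod_cast h))

theorem expNeg_le_one (a : ℝ≥0∞) : expNeg a ≤ 1 :=
  expNeg_zero ▸ antitone_expNeg (zero_le (a := a))

/-- This inverse lets a mark-averaged factor be rewritten as `expNeg` of a deterministic function;
the value ∞ covers `b = 0`. -/
theorem exists_expNeg_eq {b : ℝ≥0∞} (hb : b ≤ 1) : expNeg (-ENNReal.log b).toENNReal = b := by
  have h : 0 ≤ -ENNReal.log b := by
    rw [EReal.le_neg]; simpa using hb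
  simp [expNeg, EReal.coe_toENNReal h]

theorem tendsto_prod_expNeg (f : ℕ → ℝ≥0∞) :
    Filter.Tendsto (fun n => ∏ i ∈ Finset.range n, expNeg (f i)) Filter.atTop
      (nhds (expNeg (∑' i, f i))) := by
  simp_rw [← expNeg_sum]
  exact (continuous_expNeg.tendsto _).comp (ENNReal.tendsto_nat_tsum f)

/-! ### Independence of groups of sources -/

section Independence

variable {Ω : Type*}

theorem measurable_pi_of_measurable {δ : Type*} {β : δ → Type*} [∀ d, MeasurableSpace (β d)]
    {m : MeasurableSpace Ω} {f : Ω → ∀ d, β d} (hf : ∀ d, Measurable[m] fun ω => f ω d) :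
    Measurable[m] f :=
  measurable_pi_lambda _ hf

variable {m0 : MeasurableSpace Ω} {P : Measure Ω}

/-- Induction on `J`: the sources behind the new factor are disjoint from those behind the remaining
ones, so the two σ-algebras they generate are independent. -/
theorem lintegral_prod_of_iIndep {ι κ : Type*} {m : ι → MeasurableSpace Ω} (hm : ∀ i, m i ≤ m0)
    (hI : iIndep m P) {S : κ → Set ι} (hS : Pairwise (fun a b => Disjoint (S a) (S b)))
    {X : κ → Ω → ℝ≥0∞} (hX : ∀ k, Measurable[⨆ i ∈ S k, m i] (X k)) (J : Finset κ) :
    ∫⁻ ω, ∏ j ∈ J, X j ω ∂P = ∏ j ∈ J, ∫⁻ ω, X j ω ∂P := by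
  classical
  have := hI.isProbabilityMeasure
  induction J using Finset.induction_on with
  | empty => simp
  | insert a J ha ih =>
    simp_rw [Finset.prod_insert ha]
    rw [← ih]
    have hd : Disjoint (S a) (⋃ j ∈ J, S j) := by
      simp only [Set.disjoint_iUnion_right]
      intro j hj
      exact hS fun h => ha (h ▸ hj)
    have hind := indep_iSup_of_disjoint hm hI hd
    have h2 : Measurable[⨆ i ∈ ⋃ j ∈ J, S j, m i] (fun ω => ∏ j ∈ J, X j ω) := by
      refine Finset.measurable_prod _ fun j hj => (hX j).mono ?_ le_rfl
      exact biSup_mono fun i hi => Set.mem_biUnion hj hi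
    exact lintegral_mul_eq_lintegral_mul_lintegral_of_independent_measurableSpace
      (iSup₂_le fun i _ => hm i) (iSup₂_le fun i _ => hm i) hind (hX a) h2

/-- The product formula for expectations, applied to indicator functions. -/
theorem iIndep_iSup_of_pairwise_disjoint {ι κ : Type*} {m : ι → MeasurableSpace Ω}
    (hm : ∀ i, m i ≤ m0) (hI : iIndep m P) {S : κ → Set ι}
    (hS : Pairwise (fun a b => Disjoint (S a) (S b))) : iIndep (fun k => ⨆ i ∈ S k, m i) P := by
  classical
  rw [iIndep_iff]
  intro J f hf
  have hle : ∀ k, ⨆ i ∈ S k, m i ≤ m0 := fun k => iSup₂_le fun i _ => hm i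
  -- The product formula needs measurability for every index; off `J`, where nothing is known about
  -- `f`, the empty set is used.
  set f' : κ → Set Ω := fun k => if k ∈ J then f k else ∅ with hf'
  have h1 : ∀ k, MeasurableSet[⨆ i ∈ S k, m i] (f' k) := fun k => by
    by_cases hk : k ∈ J
    · simpa [hf', hk] using hf k hk
    · simp [hf', hk]
  have h := lintegral_prod_of_iIndep hm hI hS (X := fun k => (f' k).indicator 1)
    (fun k => (measurable_indicator_const_iff 1).2 (h1 k)) J
  have h2 : ∀ ω, ∏ j ∈ J, (f' j).indicator (1 : Ω → ℝ≥0∞) ω =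
      (⋂ j ∈ J, f j).indicator 1 ω := fun ω => by
    by_cases hω : ω ∈ ⋂ j ∈ J, f j
    · rw [Set.indicator_of_mem hω]
      refine Finset.prod_eq_one fun j hj => Set.indicator_of_mem ?_ _
      simpa [hf', hj] using Set.mem_iInter₂.1 hω j hj
    · rw [Set.indicator_of_notMem hω]
      obtain ⟨j, hj, hj'⟩ : ∃ j ∈ J, ω ∉ f j := by simpa using hω
      exact Finset.prod_eq_zero hj (Set.indicator_of_notMem (by simpa [hf', hj] using hj') _)
  simp_rw [h2] at h
  rw [lintegral_indicator_one (Finset.measurableSet_biInter J fun j hj => hle j _ (hf j hj))] at h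
  rw [h]
  refine Finset.prod_congr rfl fun j hj => ?_
  rw [lintegral_indicator_one (hle j _ (h1 j))]
  simp [hf', hj]

theorem iIndepFun_of_measurable_iSup {ι κ : Type*} {m : ι → MeasurableSpace Ω}
    (hm : ∀ i, m i ≤ m0) (hI : iIndep m P) {S : κ → Set ι}
    (hS : Pairwise (fun a b => Disjoint (S a) (S b))) {β : κ → Type*}
    {mβ : ∀ k, MeasurableSpace (β k)} {X : ∀ k, Ω → β k}
    (hX : ∀ k, Measurable[⨆ i ∈ S k, m i] (X k)) : iIndepFun X P :=
  (iIndepFun_iff_iIndep mβ X P).2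
    (iIndep_of_iIndep_of_le (iIndep_iSup_of_pairwise_disjoint hm hI hS) fun k => (hX k).comap_le)

theorem indepFun_of_measurable_iSup {ι : Type*} {m : ι → MeasurableSpace Ω}
    (hm : ∀ i, m i ≤ m0) (hI : iIndep m P) {S T : Set ι} (hST : Disjoint S T) {α β : Type*}
    [MeasurableSpace α] [MeasurableSpace β] {X : Ω → α} {Y : Ω → β}
    (hX : Measurable[⨆ i ∈ S, m i] X) (hY : Measurable[⨆ i ∈ T, m i] Y) : IndepFun X Y P :=
  (IndepFun_iff_Indep X Y P).2
    (indep_of_indep_of_le (indep_iSup_of_disjoint hm hI hST) hX.comap_le hY.comap_le)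

theorem lintegral_prod_of_iIndepFun {κ : Type*} {β : κ → Type*} {mβ : ∀ k, MeasurableSpace (β k)}
    {Y : ∀ k, Ω → β k} (hY : ∀ k, Measurable (Y k)) (hI : iIndepFun Y P) {F : ∀ k, β k → ℝ≥0∞}
    (hF : ∀ k, Measurable (F k)) (J : Finset κ) :
    ∫⁻ ω, ∏ j ∈ J, F j (Y j ω) ∂P = ∏ j ∈ J, ∫⁻ ω, F j (Y j ω) ∂P := by
  refine lintegral_prod_of_iIndep (S := fun k => {k}) (fun k => (hY k).comap_le)
    ((iIndepFun_iff_iIndep mβ Y P).1 hI) (fun a b hab => by simpa using hab)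
    (X := fun k ω => F k (Y k ω)) (fun k => ?_) J
  rw [iSup_singleton]
  exact (hF k).comp (comap_measurable _)

/-- The joint law is a product, so Tonelli allows `X` to be frozen while `Y` is averaged. This
replaces conditional expectations throughout. -/
theorem lintegral_comp_prodMk_of_indepFun {α β : Type*} [MeasurableSpace α] [MeasurableSpace β]
    [IsFiniteMeasure P] {X : Ω → α} {Y : Ω → β} (hX : Measurable X) (hY : Measurable Y)
    (h : IndepFun X Y P) {φ : α × β → ℝ≥0∞} (hφ : Measurable φ) :
    ∫⁻ ω, φ (X ω, Y ω) ∂P = ∫⁻ ω, ∫⁻ ω', φ (X ω, Y ω') ∂P ∂P := by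
  rw [← lintegral_map hφ (hX.prodMk hY),
    (indepFun_iff_map_prod_eq_prod_map_map hX.aemeasurable hY.aemeasurable).1 h,
    lintegral_prod _ hφ.aemeasurable, lintegral_map (by fun_prop) hX]
  refine lintegral_congr fun ω => ?_
  rw [lintegral_map (by fun_prop) hY]

end Independence

/-! ### Exponential gains -/

theorem nullSingletonClass_expMeasure : NullSingletonClass (expMeasure 1) :=
  inferInstanceAs (NullSingletonClass (volume.withDensity (gammaPDF 1 1)))

theorem expMeasure_Ici {a : ℝ} (ha : 0 ≤ a) :
    expMeasure 1 (Set.Ici a) = ENNReal.ofReal (Real.exp (-a)) := by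
  have := isProbabilityMeasure_expMeasure one_pos
  have := nullSingletonClass_expMeasure
  rw [← measure_congr (Ioi_ae_eq_Ici (a := a)), ← Set.compl_Iic,
    measure_compl measurableSet_Iic (measure_ne_top _ _), measure_univ,
    ← ofReal_measureReal, ← cdf_eq_real, cdf_expMeasure_eq one_pos, if_pos ha,
    ← ENNReal.ofReal_one, ← ENNReal.ofReal_sub _ (by simp [ha])]
  simp

theorem ae_pos_expMeasure : ∀ᵐ h ∂expMeasure 1, 0 < h := by
  have := isProbabilityMeasure_expMeasure one_pos
  rw [ae_iff_measure_eq (by measurability)]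
  have := nullSingletonClass_expMeasure
  change expMeasure 1 (Set.Ioi 0) = _
  rw [measure_congr (Ioi_ae_eq_Ici (a := (0:ℝ))), expMeasure_Ici le_rfl]
  simp

/-- Laplace transform of the Gamma law. -/
theorem lintegral_expNeg_gammaMeasure {b r a : ℝ} (hb : 0 < b) (hr : 0 < r) (ha : 0 ≤ a) :
    ∫⁻ h, expNeg (ENNReal.ofReal (a * h)) ∂gammaMeasure b r =
      ENNReal.ofReal ((r / (r + a)) ^ b) := by
  have h1 : 0 < r + a := by positivity
  -- Exponential tilting: the factor exp(-ax) changes the rate from `r` to `r + a`, and the ratio of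
  -- normalising constants is the transform.
  have h2 : ∀ x, 0 ≤ x → gammaPDF b r x * expNeg (ENNReal.ofReal (a * x)) =
      ENNReal.ofReal ((r / (r + a)) ^ b) * gammaPDF b (r + a) x := by
    intro x hx
    rw [gammaPDF_of_nonneg hx, gammaPDF_of_nonneg hx, expNeg_ofReal (by positivity),
      ← ENNReal.ofReal_mul' (by positivity), ← ENNReal.ofReal_mul (by positivity)]
    congr 1
    have h3 : Real.exp (-((r + a) * x)) = Real.exp (-(r * x)) * Real.exp (-(a * x)) := by
      rw [← Real.exp_add]; ring_nf
    have h4 : (r + a) ^ b ≠ 0 := (Real.rpow_pos_of_pos h1 b).ne'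
    rw [Real.div_rpow hr.le h1.le, h3]
    field_simp
  have hm : ∀ r, Measurable (gammaPDF b r) := fun r => by unfold gammaPDF; fun_prop
  have he : Measurable fun x : ℝ => expNeg (ENNReal.ofReal (a * x)) :=
    measurable_expNeg.comp (by fun_prop)
  rw [gammaMeasure, lintegral_withDensity_eq_lintegral_mul _ (hm r) he]
  calc _ = ∫⁻ x, ENNReal.ofReal ((r / (r + a)) ^ b) * gammaPDF b (r + a) x := by
        refine lintegral_congr fun x => ?_
        by_cases hx : 0 ≤ x
        · exact h2 x hx
        · simp [gammaPDF_of_neg (not_le.1 hx)]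
    _ = _ := by
        rw [lintegral_const_mul _ (hm _), lintegral_gammaPDF_eq_one hb h1, mul_one]

/-- Laplace transform of an exponential gain. -/
theorem lintegral_expNeg_expMeasure {a : ℝ} (ha : 0 ≤ a) :
    ∫⁻ h, expNeg (ENNReal.ofReal (a * h)) ∂expMeasure 1 = ENNReal.ofReal (1 / (1 + a)) := by
  rw [expMeasure, lintegral_expNeg_gammaMeasure one_pos one_pos ha, Real.rpow_one]

section Success

variable {Ω : Type*} [MeasurableSpace Ω] {P : Measure Ω} [IsProbabilityMeasure P]

/-- An exponential gain with mean one, independent of the interference, turns the success probability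
into the Laplace transform of the interference. -/
theorem measure_le_div_of_exp {h : Ω → ℝ} {I : Ω → ℝ≥0∞} (hh : Measurable h) (hI : Measurable I)
    (hlaw : P.map h = expMeasure 1) (hind : IndepFun I h P) {ρ θ : ℝ} (hρ : 0 < ρ) (hθ : 0 < θ) :
    P {ω | ENNReal.ofReal θ ≤ ENNReal.ofReal (ρ * h ω) / I ω} =
      ∫⁻ ω, expNeg (ENNReal.ofReal (θ / ρ) * I ω) ∂P := by
  set A : Set (ℝ≥0∞ × ℝ) := {z | ENNReal.ofReal θ ≤ ENNReal.ofReal (ρ * z.2) / z.1} with hA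
  have hmA : MeasurableSet A := measurableSet_le (by fun_prop) (by fun_prop)
  have h1 : P {ω | ENNReal.ofReal θ ≤ ENNReal.ofReal (ρ * h ω) / I ω} =
      ∫⁻ ω, A.indicator 1 (I ω, h ω) ∂P := by
    rw [← lintegral_indicator_one (measurableSet_le (by fun_prop) (by fun_prop))]
    rfl
  rw [h1, lintegral_comp_prodMk_of_indepFun hI hh hind (measurable_one.indicator hmA)]
  refine lintegral_congr fun ω => ?_
  generalize I ω = i
  have h2 : ∫⁻ ω', A.indicator 1 (i, h ω') ∂P = expMeasure 1 {y | (i, y) ∈ A} := by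
    have hm : MeasurableSet {y | (i, y) ∈ A} := measurable_prodMk_left hmA
    rw [← hlaw, Measure.map_apply hh hm, ← lintegral_indicator_one (hh hm)]
    rfl
  rw [h2]
  have hθ' : ENNReal.ofReal θ ≠ 0 := by simp [hθ]
  -- Infinite interference gives SINR 0: no gain succeeds, in agreement with `expNeg ∞ = 0`.
  by_cases hi : i = ∞
  · subst hi
    have : {y : ℝ | ((∞ : ℝ≥0∞), y) ∈ A} = ∅ := by
      ext y; simp [hA, hθ]
    rw [this, ENNReal.mul_top (by simp; positivity), expNeg_top, measure_empty]
  · obtain ⟨r, hr, rfl⟩ : ∃ r : ℝ, 0 ≤ r ∧ i = ENNReal.ofReal r :=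
      ⟨i.toReal, ENNReal.toReal_nonneg, (ENNReal.ofReal_toReal hi).symm⟩
    rw [← ENNReal.ofReal_mul (by positivity), expNeg_ofReal (by positivity),
      ← expMeasure_Ici (by positivity)]
    refine measure_congr ?_
    -- Positivity of the gain matters when `r = 0`: at `y = 0` the quotient 0/0 is 0, a failure,
    -- although `θ / ρ * r ≤ y` holds.
    filter_upwards [ae_pos_expMeasure] with y hy
    apply propext
    change (ENNReal.ofReal θ ≤ ENNReal.ofReal (ρ * y) / ENNReal.ofReal r) ↔ θ / ρ * r ≤ y
    have hy' : 0 < ρ * y := by positivity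
    rw [ENNReal.le_div_iff_mul_le (Or.inr (by simp [hy'])) (Or.inr (by simp)),
      ← ENNReal.ofReal_mul hθ.le, ENNReal.ofReal_le_ofReal_iff hy'.le, div_mul_eq_mul_div,
      div_le_iff₀ hρ, mul_comm y]

end Success

/-! ### Laplace functional of a Poisson process -/

/-- Probability generating function of the Poisson law. -/
theorem lintegral_pow_poissonMeasure (a : ℝ≥0) {z : ℝ≥0∞} (hz : z ≤ 1) :
    ∫⁻ n, z ^ n ∂poissonMeasure a = expNeg (a * (1 - z)) := by
  lift z to ℝ≥0 using (hz.trans_lt ENNReal.one_lt_top).ne with w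
  have hw : (w : ℝ) ≤ 1 := by exact_mod_cast hz
  rw [lintegral_countable']
  have h1 : ∀ n : ℕ, (w : ℝ≥0∞) ^ n * poissonMeasure a {n} =
      ENNReal.ofReal (Real.exp (-a) * ((a * w : ℝ) ^ n / n.factorial)) := fun n => by
    rw [poissonMeasure_singleton, ← ENNReal.ofReal_coe_nnreal, ← ENNReal.ofReal_pow w.coe_nonneg,
      ← ENNReal.ofReal_mul (by positivity)]
    congr 1
    ring
  have h2 := (NormedSpace.expSeries_div_hasSum_exp (a * w : ℝ)).mul_left (Real.exp (-a))
  simp_rw [h1]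
  rw [← ENNReal.ofReal_tsum_of_nonneg (fun n => by positivity) h2.summable, h2.tsum_eq,
    ← Real.exp_eq_exp_ℝ, ← Real.exp_add]
  have h3 : (a : ℝ≥0∞) * (1 - w) = ENNReal.ofReal (a * (1 - w)) := by
    rw [ENNReal.ofReal_mul a.coe_nonneg, ENNReal.ofReal_sub _ w.coe_nonneg, ENNReal.ofReal_coe_nnreal,
      ENNReal.ofReal_coe_nnreal, ENNReal.ofReal_one]
  rw [h3, expNeg_ofReal (mul_nonneg a.coe_nonneg (by linarith))]
  ring_nf

namespace PointProcess

variable {Ω : Type*} [MeasurableSpace Ω] {Φ : PointProcess Ω} {P : Measure Ω} {lam : ℝ}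

open Classical in
theorem tsum_ite_eq_mul_count (Φ : PointProcess Ω) (B : Set Plane) (v : ℝ≥0∞) (ω : Ω) :
    ∑' i : ℕ, (if (i : ℕ∞) < Φ.num ω ∧ Φ.pt i ω ∈ B then v else 0) = v * (Φ.count B ω : ℝ≥0∞) := by
  have h := lintegral_indicator_const (μ := Measure.count)
    (s := {i : ℕ | (i : ℕ∞) < Φ.num ω ∧ Φ.pt i ω ∈ B}) (by measurability) v
  rw [Measure.count_apply (by measurability), lintegral_count] at h
  rw [count, ← h]
  refine tsum_congr fun i => ?_
  simp [Set.indicator_apply]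

theorem measurableSet_lt_num (Φ : PointProcess Ω) (i : ℕ) :
    MeasurableSet {ω | (i : ℕ∞) < Φ.num ω} :=
  Φ.measurable_num (MeasurableSet.of_discrete (s := Set.Ioi (i : ℕ∞)))

/-- The count is a countable sum of measurable indicators once it is viewed in `ℝ≥0∞`; the embedding
of `ℕ∞` is injective, so its fibres are measurable. -/
theorem measurable_count (Φ : PointProcess Ω) {B : Set Plane} (hB : MeasurableSet B) :
    Measurable (Φ.count B) := by
  classical
  have h : Measurable fun ω => (Φ.count B ω : ℝ≥0∞) := by
    have : (fun ω => (Φ.count B ω : ℝ≥0∞)) = fun ω =>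
        ∑' i : ℕ, (if (i : ℕ∞) < Φ.num ω ∧ Φ.pt i ω ∈ B then 1 else 0) := by
      funext ω
      rw [tsum_ite_eq_mul_count, one_mul]
    rw [this]
    exact Measurable.tsum fun i => Measurable.ite
      ((Φ.measurableSet_lt_num i).inter (Φ.measurable_pt i hB)) measurable_const measurable_const
  refine measurable_to_countable' fun n => ?_
  have : Φ.count B ⁻¹' {n} = (fun ω => (Φ.count B ω : ℝ≥0∞)) ⁻¹' {(n : ℝ≥0∞)} := by
    ext ω; simp
  rw [this]
  exact h (measurableSet_singleton _)

theorem IsPoisson.map_count [IsProbabilityMeasure P] (hΦ : Φ.IsPoisson lam P) {B : Set Plane}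
    (hB : MeasurableSet B) (hB' : volume B ≠ ∞) :
    P.map (Φ.count B) =
      (poissonMeasure (ENNReal.ofReal lam * volume B).toNNReal).map (Nat.cast : ℕ → ℕ∞) := by
  have hm := Φ.measurable_count hB
  have hc : Measurable (Nat.cast : ℕ → ℕ∞) := measurable_from_top
  set μ := P.map (Φ.count B) with hμ
  set ν := (poissonMeasure (ENNReal.ofReal lam * volume B).toNNReal).map (Nat.cast : ℕ → ℕ∞) with hν
  have : IsProbabilityMeasure μ := Measure.isProbabilityMeasure_map hm.aemeasurable
  have : IsProbabilityMeasure ν := Measure.isProbabilityMeasure_map hc.aemeasurable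
  have h1 : ∀ n : ℕ, μ {(n : ℕ∞)} = ν {(n : ℕ∞)} := fun n => by
    rw [hμ, hν, Measure.map_apply hm (by measurability), Measure.map_apply hc (by measurability)]
    have : (Nat.cast : ℕ → ℕ∞) ⁻¹' {(n : ℕ∞)} = {n} := by ext; simp
    rw [this, ← hΦ.law_count B hB hB' n]
    rfl
  have h2 : ({⊤} : Set ℕ∞) = (⋃ n : ℕ, {(n : ℕ∞)})ᶜ := by
    ext x
    simp only [Set.mem_singleton_iff, Set.mem_compl_iff, Set.mem_iUnion, not_exists]
    cases x <;> simp
  refine Measure.ext_of_singleton fun a => ?_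
  cases a with
  | coe n => exact h1 n
  -- `law_count` speaks of finite values only. Both laws have total mass one, so the mass at ⊤ is
  -- determined by the finite masses.
  | top =>
    have hd : Pairwise (Function.onFun Disjoint fun n : ℕ => ({(n : ℕ∞)} : Set ℕ∞)) := by
      intro a b hab
      simpa [Function.onFun] using hab
    rw [h2, prob_compl_eq_one_sub (by measurability), prob_compl_eq_one_sub (by measurability),
      measure_iUnion hd (by measurability), measure_iUnion hd (by measurability)]
    simp_rw [h1]

theorem IsPoisson.lintegral_expNeg_mul_count [IsProbabilityMeasure P] (hΦ : Φ.IsPoisson lam P)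
    {B : Set Plane} (hB : MeasurableSet B) (hB' : volume B ≠ ∞) (v : ℝ≥0∞) :
    ∫⁻ ω, expNeg (v * (Φ.count B ω : ℝ≥0∞)) ∂P =
      expNeg (ENNReal.ofReal lam * ((1 - expNeg v) * volume B)) := by
  have hc : Measurable (Nat.cast : ℕ → ℕ∞) := measurable_from_top
  have hm : Measurable fun c : ℕ∞ => expNeg (v * (c : ℝ≥0∞)) := measurable_from_top
  rw [← lintegral_map hm (Φ.measurable_count hB), hΦ.map_count hB hB', lintegral_map hm hc]
  simp_rw [ENat.toENNReal_coe, mul_comm v, expNeg_nsmul]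
  rw [lintegral_pow_poissonMeasure _ (expNeg_le_one v),
    ENNReal.coe_toNNReal (ENNReal.mul_ne_top ENNReal.ofReal_ne_top hB')]
  ring_nf

/-- Sum of `f` over the points of the process. -/
def pointSum (Φ : PointProcess Ω) (f : Plane → ℝ≥0∞) (ω : Ω) : ℝ≥0∞ :=
  ∑' i : ℕ, {i : ℕ | (i : ℕ∞) < Φ.num ω}.indicator (fun i => f (Φ.pt i ω)) i

theorem measurable_pointSum (Φ : PointProcess Ω) {f : Plane → ℝ≥0∞} (hf : Measurable f) :
    Measurable (Φ.pointSum f) := by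
  refine Measurable.tsum fun i => ?_
  exact (hf.comp (Φ.measurable_pt i)).indicator (Φ.measurableSet_lt_num i)

/-- The value 0 is left out because its level set may have infinite area, where `law_count` does not
apply. -/
theorem pointSum_simpleFunc (Φ : PointProcess Ω) (g : SimpleFunc Plane ℝ≥0∞) (ω : Ω) :
    Φ.pointSum g ω = ∑ v ∈ g.range.erase 0, v * (Φ.count (g ⁻¹' {v}) ω : ℝ≥0∞) := by
  classical
  simp_rw [← tsum_ite_eq_mul_count, pointSum]
  rw [← Summable.tsum_finsetSum (fun _ _ => ENNReal.summable)]
  refine tsum_congr fun i => ?_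
  by_cases hi : (i : ℕ∞) < Φ.num ω
  · rw [Set.indicator_of_mem (by exact hi)]
    simp only [hi, true_and, Set.mem_preimage, Set.mem_singleton_iff]
    rw [Finset.sum_ite_eq]
    by_cases h0 : g (Φ.pt i ω) = 0 <;> simp [h0]
  · rw [Set.indicator_of_notMem (by exact hi)]
    simp [hi]

/-- Level sets of different values are disjoint, so their counts are independent Poisson variables
and the generating functions multiply. -/
theorem IsPoisson.lintegral_expNeg_pointSum_simpleFunc [IsProbabilityMeasure P]
    (hΦ : Φ.IsPoisson lam P) (g : SimpleFunc Plane ℝ≥0∞)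
    (hg : ∀ v ≠ 0, volume (g ⁻¹' {v}) ≠ ∞) :
    ∫⁻ ω, expNeg (Φ.pointSum g ω) ∂P =
      expNeg (ENNReal.ofReal lam * ∫⁻ y, (1 - expNeg (g y))) := by
  classical
  set s := g.range.erase 0 with hs
  have hB : ∀ v, MeasurableSet (g ⁻¹' {v}) := fun v => g.measurableSet_fiber v
  have hdisj : Pairwise fun i j : Fin s.card =>
      Disjoint (g ⁻¹' {(s.equivFin.symm i : ℝ≥0∞)}) (g ⁻¹' {(s.equivFin.symm j : ℝ≥0∞)}) := by
    intro i j hij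
    refine Disjoint.preimage _ ?_
    rw [Set.disjoint_singleton]
    exact fun h => hij (s.equivFin.symm.injective (Subtype.ext h))
  -- `indep_count` is stated for families indexed by `Fin n`, so the nonzero values of `g` are
  -- enumerated.
  have hreindex : ∀ F : ℝ≥0∞ → ℝ≥0∞, ∏ v ∈ s, F v = ∏ j, F (s.equivFin.symm j : ℝ≥0∞) := by
    intro F
    rw [← Finset.prod_coe_sort]
    exact (Equiv.prod_comp s.equivFin.symm fun v : s => F v).symm
  have hsing : Pairwise fun i j : Fin s.card => Disjoint ({i} : Set (Fin s.card)) {j} :=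
    fun i j hij => by simpa using hij
  simp_rw [pointSum_simpleFunc, expNeg_sum, ← hs, hreindex]
  rw [lintegral_prod_of_iIndep (fun j => (Φ.measurable_count (hB _)).comap_le)
    (hΦ.indep_count _ _ (fun j => hB (s.equivFin.symm j : ℝ≥0∞)) hdisj) hsing]
  · rw [← hreindex fun v => ∫⁻ ω, expNeg (v * (Φ.count (g ⁻¹' {v}) ω : ℝ≥0∞)) ∂P]
    have : ∀ v ∈ s, ∫⁻ ω, expNeg (v * (Φ.count (g ⁻¹' {v}) ω : ℝ≥0∞)) ∂P =
        expNeg (ENNReal.ofReal lam * ((1 - expNeg v) * volume (g ⁻¹' {v}))) := fun v hv =>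
      hΦ.lintegral_expNeg_mul_count (hB v) (hg v (Finset.ne_of_mem_erase hv)) v
    rw [Finset.prod_congr rfl this, ← expNeg_sum, ← Finset.mul_sum]
    congr 2
    have h1 : ∫⁻ y, (1 - expNeg (g y)) = (g.map fun v => 1 - expNeg v).lintegral volume := by
      rw [← SimpleFunc.lintegral_eq_lintegral]
      rfl
    rw [h1, SimpleFunc.map_lintegral]
    -- The value 0 can be put back: it contributes `1 - expNeg 0 = 0`, whatever the area of its
    -- level set.
    refine Finset.sum_subset (Finset.erase_subset _ _) fun v hv hv' => ?_
    have : v = 0 := by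
      by_contra h
      exact hv' (Finset.mem_erase.2 ⟨h, hv⟩)
    simp [this, expNeg_zero]
  · intro j
    rw [iSup_singleton]
    have hm : Measurable fun c : ℕ∞ => expNeg ((s.equivFin.symm j : ℝ≥0∞) * (c : ℝ≥0∞)) :=
      measurable_from_top
    exact hm.comp (comap_measurable _)

/-- Laplace functional of a homogeneous Poisson point process. -/
theorem IsPoisson.lintegral_expNeg_pointSum [IsProbabilityMeasure P] (hΦ : Φ.IsPoisson lam P)
    {f : Plane → ℝ≥0∞} (hf : Measurable f) :
    ∫⁻ ω, expNeg (Φ.pointSum f ω) ∂P =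
      expNeg (ENNReal.ofReal lam * ∫⁻ y, (1 - expNeg (f y))) := by
  -- Cutting the simple approximations off outside growing balls gives nonzero level sets finite
  -- area and keeps the increasing convergence to `f`.
  set g : ℕ → SimpleFunc Plane ℝ≥0∞ := fun n =>
    (SimpleFunc.eapprox f n).restrict (Metric.ball 0 n) with hg
  have hgapp : ∀ n y, g n y = (Metric.ball 0 (n : ℝ)).indicator (SimpleFunc.eapprox f n) y :=
    fun n y => SimpleFunc.restrict_apply _ Metric.isOpen_ball.measurableSet y
  have hmono : ∀ y, Monotone fun n => g n y := by
    intro y m n hmn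
    simp only [hgapp]
    refine (Set.indicator_le_indicator_of_subset
      (Metric.ball_subset_ball (Nat.cast_le.2 hmn)) (fun _ => zero_le) y).trans ?_
    exact Set.indicator_le_indicator (SimpleFunc.monotone_eapprox f hmn y)
  have hlim : ∀ y, Filter.Tendsto (fun n => g n y) Filter.atTop (nhds (f y)) := by
    intro y
    refine (SimpleFunc.tendsto_eapprox hf y).congr' ?_
    obtain ⟨n0, hn0⟩ := exists_nat_gt ‖y‖
    filter_upwards [Filter.eventually_ge_atTop n0] with n hn
    rw [hgapp, Set.indicator_of_mem]
    have : (n0 : ℝ) ≤ n := by exact_mod_cast hn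
    simp; linarith
  have hfin : ∀ n, ∀ v ≠ 0, volume (g n ⁻¹' {v}) ≠ ∞ := by
    intro n v hv
    refine ne_top_of_le_ne_top (measure_ball_lt_top (x := (0 : Plane)) (r := n)).ne
      (measure_mono fun y hy => ?_)
    by_contra h
    rw [Set.mem_preimage, hgapp, Set.indicator_of_notMem h] at hy
    exact hv (by simpa using hy.symm)
  -- Monotone convergence inside each point sum, then dominated convergence with bound 1 over `ω`.
  have hL : Filter.Tendsto (fun n => ∫⁻ ω, expNeg (Φ.pointSum (g n) ω) ∂P) Filter.atTop
      (nhds (∫⁻ ω, expNeg (Φ.pointSum f ω) ∂P)) := by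
    refine tendsto_lintegral_of_dominated_convergence (fun _ => 1)
      (fun n => measurable_expNeg.comp (Φ.measurable_pointSum (g n).measurable))
      (fun n => Filter.Eventually.of_forall fun ω => expNeg_le_one _) (by simp)
      (Filter.Eventually.of_forall fun ω => (continuous_expNeg.tendsto _).comp ?_)
    simp only [pointSum, ← lintegral_count]
    refine lintegral_tendsto_of_tendsto_of_monotone (fun n => measurable_from_top.aemeasurable)
      (Filter.Eventually.of_forall fun i m n hmn => Set.indicator_le_indicator (hmono _ hmn))
      (Filter.Eventually.of_forall fun i => ?_)
    by_cases hi : (i : ℕ∞) < Φ.num ω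
    · simpa [Set.indicator_apply, hi] using hlim _
    · simp [hi]
  have hR : Filter.Tendsto (fun n => expNeg (ENNReal.ofReal lam * ∫⁻ y, (1 - expNeg (g n y))))
      Filter.atTop (nhds (expNeg (ENNReal.ofReal lam * ∫⁻ y, (1 - expNeg (f y))))) := by
    refine (continuous_expNeg.tendsto _).comp
      (ENNReal.Tendsto.const_mul ?_ (Or.inr ENNReal.ofReal_ne_top))
    refine lintegral_tendsto_of_tendsto_of_monotone
      (fun n => ((measurable_expNeg.comp (g n).measurable).const_sub 1).aemeasurable)
      (Filter.Eventually.of_forall fun y m n hmn =>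
        tsub_le_tsub_left (antitone_expNeg (hmono y hmn)) 1)
      (Filter.Eventually.of_forall fun y => ?_)
    exact ENNReal.Tendsto.sub tendsto_const_nhds ((continuous_expNeg.tendsto _).comp (hlim y))
      (Or.inl ENNReal.one_ne_top)
  refine tendsto_nhds_unique hL (hR.congr fun n => ?_)
  rw [hΦ.lintegral_expNeg_pointSum_simpleFunc (g n) (hfin n)]

end PointProcess

/-! ### Intra-cell and inter-cell interference -/

section Marked

variable {Ω : Type*} [MeasurableSpace Ω] {P : Measure Ω}

/-- Probability generating functional of a random number of independent terms. -/
theorem lintegral_prod_range_of_indepFun [IsFiniteMeasure P] {β : Type*} [MeasurableSpace β]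
    {N : Ω → ℕ} {Y : ℕ → Ω → β} (hN : Measurable N) (hY : ∀ n, Measurable (Y n))
    (hNY : IndepFun N (fun ω n => Y n ω) P) (hI : iIndepFun Y P) {F : β → ℝ≥0∞}
    (hF : Measurable F) {z : ℝ≥0∞} (hz : ∀ n, ∫⁻ ω, F (Y n ω) ∂P = z) :
    ∫⁻ ω, ∏ n ∈ Finset.range (N ω), F (Y n ω) ∂P = ∫⁻ n, z ^ n ∂P.map N := by
  have hφ : Measurable fun w : ℕ × (ℕ → β) => ∏ n ∈ Finset.range w.1, F (w.2 n) :=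
    measurable_from_prod_countable_right fun n =>
      Finset.measurable_prod (Finset.range n) (f := fun i (y : ℕ → β) => F (y i))
        fun i _ => hF.comp (measurable_pi_apply i)
  rw [lintegral_comp_prodMk_of_indepFun hN (measurable_pi_lambda _ hY) hNY hφ,
    lintegral_map measurable_from_top hN]
  refine lintegral_congr fun ω => ?_
  dsimp only
  rw [lintegral_prod_of_iIndepFun hY hI (fun _ => hF)]
  simp [hz]

theorem measurable_poissonMeasure : Measurable poissonMeasure := by
  refine Measure.measurable_of_measurable_coe _ fun s _ => ?_
  simp only [poissonMeasure, Measure.sum_apply_of_countable, Measure.smul_apply]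
  refine Measurable.tsum fun n => ?_
  simp only [smul_eq_mul]
  fun_prop

/-- Given the area `A`, the generating function at 1/(1+t) is exp(-uA·t/(1+t)); what remains is the
Gamma Laplace transform at u·t/(1+t). -/
theorem lintegral_pow_cellCountLaw {lam u t : ℝ} (hlam : 0 < lam) (hu : 0 ≤ u) (ht : 0 ≤ t) :
    ∫⁻ n, ENNReal.ofReal (1 / (1 + t)) ^ n ∂cellCountLaw lam u =
      ENNReal.ofReal ((voronoiShape * lam / (voronoiShape * lam + u * (t / (1 + t)))) ^
        voronoiShape) := by
  have hc : 0 < voronoiShape := by norm_num [voronoiShape]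
  have hm : Measurable fun A : ℝ => poissonMeasure (u * A).toNNReal :=
    measurable_poissonMeasure.comp (by fun_prop)
  have hz : ENNReal.ofReal (1 / (1 + t)) ≤ 1 := by
    rw [ENNReal.ofReal_le_one]
    exact div_le_one_of_le₀ (by linarith) (by positivity)
  rw [cellCountLaw, Measure.lintegral_bind hm.aemeasurable measurable_from_top.aemeasurable,
    ← lintegral_expNeg_gammaMeasure hc (by positivity) (by positivity)]
  refine lintegral_congr fun A => ?_
  rw [lintegral_pow_poissonMeasure _ hz]
  congr 1
  have h1 : 1 - ENNReal.ofReal (1 / (1 + t)) = ENNReal.ofReal (t / (1 + t)) := by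
    rw [← ENNReal.ofReal_one, ← ENNReal.ofReal_sub _ (by positivity)]
    congr 1
    field_simp
    ring
  rw [h1]
  -- Truncation at zero occurs on both sides, so negative `A` needs no separate treatment.
  change ENNReal.ofReal (u * A) * _ = _
  rw [← ENNReal.ofReal_mul' (by positivity)]
  congr 1
  ring

/-- Sum of a function of the mark and the position over an enumerated configuration of points. -/
def markedSum {β : Type*} (φ : β × Plane → ℝ≥0∞) (w : (ℕ∞ × (ℕ → Plane)) × (ℕ → β)) : ℝ≥0∞ :=
  ∑' i : ℕ, {i : ℕ | (i : ℕ∞) < w.1.1}.indicator (fun i => φ (w.2 i, w.1.2 i)) i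

theorem measurable_indicator_lt_num {β : Type*} [MeasurableSpace β] {φ : β × Plane → ℝ≥0∞}
    (hφ : Measurable φ) (i : ℕ) : Measurable fun w : (ℕ∞ × (ℕ → Plane)) × (ℕ → β) =>
      {i : ℕ | (i : ℕ∞) < w.1.1}.indicator (fun i => φ (w.2 i, w.1.2 i)) i := by
  have hs : MeasurableSet {w : (ℕ∞ × (ℕ → Plane)) × (ℕ → β) | (i : ℕ∞) < w.1.1} :=
    (measurable_fst.comp measurable_fst) (MeasurableSet.of_discrete (s := Set.Ioi (i : ℕ∞)))
  exact Measurable.indicator (f := fun w : (ℕ∞ × (ℕ → Plane)) × (ℕ → β) => φ (w.2 i, w.1.2 i))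
    (by fun_prop) hs

theorem measurable_markedSum {β : Type*} [MeasurableSpace β] {φ : β × Plane → ℝ≥0∞}
    (hφ : Measurable φ) : Measurable (markedSum φ) :=
  Measurable.tsum (measurable_indicator_lt_num hφ)

theorem const_mul_markedSum {β : Type*} (s : ℝ≥0∞) (φ : β × Plane → ℝ≥0∞)
    (w : (ℕ∞ × (ℕ → Plane)) × (ℕ → β)) :
    s * markedSum φ w = markedSum (fun z => s * φ z) w := by
  rw [markedSum, ← ENNReal.tsum_mul_left]
  refine tsum_congr fun i => ?_
  simp only [Set.indicator_apply]
  split_ifs <;> simp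

/-- Laplace functional of a Poisson process with independent marks. -/
theorem PointProcess.IsPoisson.lintegral_expNeg_markedSum [IsProbabilityMeasure P]
    {Φ : PointProcess Ω} {lam : ℝ} (hΦ : Φ.IsPoisson lam P) {β : Type*} [MeasurableSpace β]
    {Y : ℕ → Ω → β} (hY : ∀ i, Measurable (Y i))
    (hΦY : IndepFun (fun ω => (Φ.num ω, fun i => Φ.pt i ω)) (fun ω i => Y i ω) P)
    (hI : iIndepFun Y P) {φ : β × Plane → ℝ≥0∞} (hφ : Measurable φ) {g : Plane → ℝ≥0∞}
    (hg : ∀ i y, ∫⁻ ω, expNeg (φ (Y i ω, y)) ∂P = g y) :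
    ∫⁻ ω, expNeg (markedSum φ ((Φ.num ω, fun i => Φ.pt i ω), fun i => Y i ω)) ∂P =
      expNeg (ENNReal.ofReal lam * ∫⁻ y, (1 - g y)) := by
  have hgm : Measurable g := by
    have h : g = fun y => ∫⁻ ω, expNeg (φ (Y 0 ω, y)) ∂P := funext fun y => (hg 0 y).symm
    rw [h]
    exact (measurable_expNeg.comp
      (hφ.comp (((hY 0).comp measurable_snd).prodMk measurable_fst))).lintegral_prod_right'
  have hg1 : ∀ y, g y ≤ 1 := fun y => by
    rw [← hg 0 y]
    exact (lintegral_mono fun ω => expNeg_le_one _).trans (by simp)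
  set ψ : (ℕ∞ × (ℕ → Plane)) × (ℕ → β) → ℕ → ℝ≥0∞ := fun w i =>
    {i : ℕ | (i : ℕ∞) < w.1.1}.indicator (fun i => φ (w.2 i, w.1.2 i)) i with hψ
  have hψm : ∀ i, Measurable fun w => ψ w i := measurable_indicator_lt_num hφ
  have hDm : Measurable fun ω => (Φ.num ω, fun i => Φ.pt i ω) :=
    Φ.measurable_num.prodMk (measurable_pi_lambda _ Φ.measurable_pt)
  -- Freeze the configuration and average over the marks alone.
  have key := lintegral_comp_prodMk_of_indepFun hDm (measurable_pi_lambda _ hY) hΦY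
    (φ := fun w => expNeg (markedSum φ w)) (measurable_expNeg.comp (measurable_markedSum hφ))
  refine key.trans ?_
  -- With `f = -log g`, the product of averaged factors over the points is `expNeg` of an unmarked
  -- point sum.
  set f : Plane → ℝ≥0∞ := fun y => (-ENNReal.log (g y)).toENNReal with hf
  have hfg : ∀ y, expNeg (f y) = g y := fun y => exists_expNeg_eq (hg1 y)
  have hfm : Measurable f := hgm.ennreal_log.neg.ereal_toENNReal
  have hpp := hΦ.lintegral_expNeg_pointSum hfm
  simp_rw [hfg] at hpp
  rw [← hpp]
  refine lintegral_congr fun ω => ?_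
  have hlim : Filter.Tendsto (fun n => ∫⁻ ω', ∏ i ∈ Finset.range n,
      expNeg (ψ ((Φ.num ω, fun i => Φ.pt i ω), fun i => Y i ω') i) ∂P) Filter.atTop
      (nhds (∫⁻ ω', expNeg (∑' i, ψ ((Φ.num ω, fun i => Φ.pt i ω), fun i => Y i ω') i) ∂P)) := by
    refine tendsto_lintegral_of_dominated_convergence (fun _ => 1) (fun n => ?_)
      (fun n => Filter.Eventually.of_forall fun ω' => Finset.prod_le_one' fun i _ => expNeg_le_one _)
      (by simp) (Filter.Eventually.of_forall fun ω' => tendsto_prod_expNeg _)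
    refine Finset.measurable_prod _ fun i _ => measurable_expNeg.comp ((hψm i).comp ?_)
    exact measurable_const.prodMk (measurable_pi_lambda _ hY)
  -- Independence of the marks is applied to finite partial products; both sides are limits of the
  -- same sequence.
  refine tendsto_nhds_unique hlim ((tendsto_prod_expNeg _).congr fun n => ?_)
  have hF : ∀ i, Measurable fun b : β =>
      expNeg ({i : ℕ | (i : ℕ∞) < Φ.num ω}.indicator (fun i => φ (b, Φ.pt i ω)) i) := fun i => by
    by_cases hi : (i : ℕ∞) < Φ.num ω
    · simp only [Set.indicator_apply, Set.mem_ofPred_eq, hi, if_true]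
      exact measurable_expNeg.comp (by fun_prop)
    · simp [hi]
  refine (Finset.prod_congr rfl fun i _ => ?_).trans
    (lintegral_prod_of_iIndepFun hY hI hF (Finset.range n)).symm
  by_cases hi : (i : ℕ∞) < Φ.num ω
  · simp [hi, hfg, hg]
  · simp [hi, expNeg_zero]

end Marked

/-! ### Distance to the nearest base station -/

namespace PointProcess

variable {Ω : Type*} [MeasurableSpace Ω] {Φ : PointProcess Ω} {P : Measure Ω} {lam : ℝ}

theorem IsPoisson.measure_count_ball_eq_zero (hΦ : Φ.IsPoisson lam P) (hlam : 0 < lam) {a : ℝ}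
    (ha : 0 ≤ a) :
    P {ω | Φ.count (Metric.ball 0 a) ω = 0} = ENNReal.ofReal (Real.exp (-(lam * Real.pi * a ^ 2))) := by
  have h := hΦ.law_count (Metric.ball 0 a) Metric.isOpen_ball.measurableSet
    measure_ball_lt_top.ne 0
  rw [Nat.cast_zero] at h
  rw [h, poissonMeasure_singleton, EuclideanSpace.volume_ball_fin_two,
    ← ENNReal.ofReal_pow ha, ← ENNReal.ofReal_mul (by positivity), ← ENNReal.ofReal_mul hlam.le,
    ENNReal.coe_toNNReal_eq_toReal, ENNReal.toReal_ofReal (by positivity)]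
  simp only [pow_zero, mul_one, Nat.factorial_zero, Nat.cast_one, div_one]
  ring_nf

theorem count_ball_eq_zero_iff (Φ : PointProcess Ω) (a : ℝ) (ω : Ω) :
    Φ.count (Metric.ball 0 a) ω = 0 ↔ ∀ i : ℕ, (i : ℕ∞) < Φ.num ω → a ≤ ‖Φ.pt i ω‖ := by
  simp [count, Set.eq_empty_iff_forall_notMem]

/-- An empty process leaves every ball empty, and void probabilities of large balls tend to 0. This
case must be excluded because `Metric.infDist` to the empty set is 0 by convention. -/
theorem IsPoisson.ae_num_ne_zero (hΦ : Φ.IsPoisson lam P) (hlam : 0 < lam) :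
    ∀ᵐ ω ∂P, Φ.num ω ≠ 0 := by
  have h1 : ∀ n : ℕ, P {ω | Φ.num ω = 0} ≤
      ENNReal.ofReal (Real.exp (-(lam * Real.pi * (n : ℝ) ^ 2))) := fun n => by
    rw [← hΦ.measure_count_ball_eq_zero hlam (Nat.cast_nonneg n)]
    refine measure_mono fun ω hω => ?_
    rw [Set.mem_ofPred_eq] at hω
    simp [count_ball_eq_zero_iff, hω]
  have h2 : Filter.Tendsto (fun n : ℕ =>
      ENNReal.ofReal (Real.exp (-(lam * Real.pi * (n : ℝ) ^ 2)))) Filter.atTop (nhds 0) := by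
    rw [← ENNReal.ofReal_zero]
    refine (ENNReal.continuous_ofReal.tendsto 0).comp (Real.tendsto_exp_neg_atTop_nhds_zero.comp ?_)
    exact Filter.Tendsto.const_mul_atTop (by positivity)
      ((Filter.tendsto_pow_atTop two_ne_zero).comp tendsto_natCast_atTop_atTop)
  have h3 : P {ω | Φ.num ω = 0} = 0 := le_antisymm (ge_of_tendsto' h2 h1) zero_le
  simpa [ae_iff] using h3

theorem IsPoisson.measure_le_distToOrigin (hΦ : Φ.IsPoisson lam P) (hlam : 0 < lam) {a : ℝ}
    (ha : 0 ≤ a) :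
    P {ω | a ≤ Φ.distToOrigin ω} = ENNReal.ofReal (Real.exp (-(lam * Real.pi * a ^ 2))) := by
  rw [← hΦ.measure_count_ball_eq_zero hlam ha]
  refine measure_congr ?_
  filter_upwards [hΦ.ae_num_ne_zero hlam] with ω hω
  apply propext
  change a ≤ Φ.distToOrigin ω ↔ Φ.count (Metric.ball 0 a) ω = 0
  rw [count_ball_eq_zero_iff, distToOrigin, Metric.le_infDist]
  · simp only [Set.mem_ofPred_eq, forall_exists_index, and_imp, dist_zero_left]
    exact ⟨fun h i hi => h i hi rfl, fun h y i hi hy => hy ▸ h i hi⟩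
  · exact ⟨Φ.pt 0 ω, 0, by simpa [pos_iff_ne_zero] using hω, rfl⟩

theorem distToOrigin_nonneg (Φ : PointProcess Ω) (ω : Ω) : 0 ≤ Φ.distToOrigin ω :=
  Metric.infDist_nonneg

/-- Mean squared distance to the nearest point of a Poisson process. -/
theorem IsPoisson.lintegral_distToOrigin_sq (hΦ : Φ.IsPoisson lam P) (hlam : 0 < lam)
    (hm : AEMeasurable Φ.distToOrigin P) :
    ∫⁻ ω, ENNReal.ofReal (Φ.distToOrigin ω ^ 2) ∂P = ENNReal.ofReal (1 / (lam * Real.pi)) := by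
  have hb : 0 < lam * Real.pi := by positivity
  -- Layer-cake formula: the squared distance has the exponential tail exp(-λπt).
  rw [lintegral_eq_lintegral_meas_le P (Filter.Eventually.of_forall fun ω => sq_nonneg _)
    (hm.pow_const 2)]
  have h1 : ∀ t ∈ Set.Ioi (0 : ℝ), P {ω | t ≤ Φ.distToOrigin ω ^ 2} =
      ENNReal.ofReal (Real.exp (-(lam * Real.pi) * t)) := by
    intro t ht
    have ht' : 0 ≤ t := (Set.mem_Ioi.1 ht).le
    have : {ω | t ≤ Φ.distToOrigin ω ^ 2} = {ω | √t ≤ Φ.distToOrigin ω} := by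
      ext ω
      exact (Real.sqrt_le_left (Φ.distToOrigin_nonneg ω)).symm
    rw [this, hΦ.measure_le_distToOrigin hlam (Real.sqrt_nonneg t), Real.sq_sqrt ht']
    ring_nf
  rw [setLIntegral_congr_fun measurableSet_Ioi h1, ← ofReal_integral_eq_lintegral_ofReal
    (exp_neg_integrableOn_Ioi 0 hb) (Filter.Eventually.of_forall fun _ => (Real.exp_pos _).le),
    integral_exp_mul_Ioi (neg_lt_zero.2 hb)]
  congr 1
  simp

end PointProcess

/-! ### The interference integral -/

/-- For `c = b + 1` the power of `1 - u` disappears and the Gamma quotient is `b`. -/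
theorem gaussHypergeometric_one_add_one {b : ℝ} (hb : 0 < b) (z : ℝ) :
    gaussHypergeometric 1 b (b + 1) z =
      b * ∫ u in Set.Ioo (0 : ℝ) 1, u ^ (b - 1) * (1 - z * u)⁻¹ := by
  have h1 : b + 1 - b - 1 = 0 := by ring
  have h2 := (Real.Gamma_pos_of_pos hb).ne'
  rw [gaussHypergeometric, intervalIntegral.integral_of_le zero_le_one, integral_Ioc_eq_integral_Ioo,
    Real.Gamma_add_one hb.ne', h1, add_sub_cancel_left, Real.Gamma_one]
  simp only [Real.rpow_zero, Real.rpow_neg_one, mul_one]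
  field_simp

theorem integrableOn_rpow_mul_inv {b t : ℝ} (hb : 0 < b) (ht : 0 ≤ t) :
    IntegrableOn (fun u : ℝ => u ^ (b - 1) * (1 + t * u)⁻¹) (Set.Ioo 0 1) := by
  have h1 : IntegrableOn (fun u : ℝ => u ^ (b - 1)) (Set.Ioo 0 1) :=
    ((intervalIntegrable_iff_integrableOn_Ioc_of_le zero_le_one).1
      (intervalIntegral.intervalIntegrable_rpow' (by linarith))).mono_set Set.Ioo_subset_Ioc_self
  refine h1.mono' (by fun_prop) ?_
  filter_upwards [ae_restrict_mem measurableSet_Ioo] with u hu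
  have hu0 := hu.1
  have h2 : 0 < u ^ (b - 1) := Real.rpow_pos_of_pos hu0 _
  rw [Real.norm_of_nonneg (by positivity)]
  refine mul_le_of_le_one_right h2.le (inv_le_one_of_one_le₀ ?_)
  nlinarith

theorem image_mul_rpow_Ioo {r eta : ℝ} (hr : 0 < r) (heta : 0 < eta) :
    (fun v : ℝ => r * v ^ (-(1 / eta))) '' Set.Ioo 0 1 = Set.Ioi r := by
  ext w
  simp only [Set.mem_image, Set.mem_Ioo, Set.mem_Ioi]
  constructor
  · rintro ⟨v, ⟨h0, h1⟩, rfl⟩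
    have : 1 < v ^ (-(1 / eta)) :=
      Real.one_lt_rpow_of_pos_of_lt_one_of_neg h0 h1 (by simpa using heta)
    nlinarith
  · intro hw
    have hw0 : 0 < w := hr.trans hw
    refine ⟨(w / r) ^ (-eta), ⟨by positivity, ?_⟩, ?_⟩
    · exact Real.rpow_lt_one_of_one_lt_of_neg ((one_lt_div hr).2 hw) (by linarith)
    · rw [← Real.rpow_mul (by positivity)]
      have : -eta * -(1 / eta) = 1 := by field_simp
      rw [this, Real.rpow_one]
      field_simp

/-- Under w = r v^(-1/η) the quantity r^η w^(-η) becomes `v`, and w > r becomes 0 < v < 1. The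
Jacobian leaves r² times the Euler integral with b = 1 - 2/η, which is positive exactly when η > 2.
-/
theorem integral_Ioi_interference {r t eta : ℝ} (hr : 0 < r) (ht : 0 ≤ t) (heta : 2 < eta) :
    IntegrableOn (fun w : ℝ => w * (t * r ^ eta * w ^ (-eta) / (1 + t * r ^ eta * w ^ (-eta))))
      (Set.Ioi r) ∧
    ∫ w in Set.Ioi r, w * (t * r ^ eta * w ^ (-eta) / (1 + t * r ^ eta * w ^ (-eta))) =
      r ^ 2 * (t / (eta - 2) * gaussHypergeometric 1 (1 - 2 / eta) (2 - 2 / eta) (-t)) := by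
  have he0 : 0 < eta := by linarith
  have hb : 0 < 1 - 2 / eta := by
    rw [sub_pos, div_lt_one he0]; exact heta
  set f : ℝ → ℝ := fun v => r * v ^ (-(1 / eta)) with hf
  have hd : ∀ v ∈ Set.Ioo (0 : ℝ) 1,
      HasDerivWithinAt f (r * (-(1 / eta) * v ^ (-(1 / eta) - 1))) (Set.Ioo 0 1) v := fun v hv =>
    ((Real.hasDerivAt_rpow_const (Or.inl hv.1.ne')).const_mul r).hasDerivWithinAt
  have hinj : Set.InjOn f (Set.Ioo 0 1) := by
    intro u hu v hv h
    have h' := mul_left_cancel₀ hr.ne' h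
    exact (Real.rpow_left_inj hu.1.le hv.1.le (by simpa using he0.ne')).1 h'
  have hval : ∀ v ∈ Set.Ioo (0 : ℝ) 1, |r * (-(1 / eta) * v ^ (-(1 / eta) - 1))| •
      (f v * (t * r ^ eta * f v ^ (-eta) / (1 + t * r ^ eta * f v ^ (-eta)))) =
      r ^ 2 * (t / eta) * (v ^ (1 - 2 / eta - 1) * (1 + t * v)⁻¹) := by
    intro v hv
    have hv0 := hv.1
    have h1 : r ^ eta * f v ^ (-eta) = v := by
      rw [hf]
      dsimp only
      rw [Real.mul_rpow hr.le (by positivity), ← Real.rpow_mul hv0.le, ← mul_assoc,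
        ← Real.rpow_add hr, add_neg_cancel, Real.rpow_zero, one_mul]
      have : -(1 / eta) * -eta = 1 := by field_simp
      rw [this, Real.rpow_one]
    have h2 : |r * (-(1 / eta) * v ^ (-(1 / eta) - 1))| = r / eta * v ^ (-(1 / eta) - 1) := by
      rw [show r * (-(1 / eta) * v ^ (-(1 / eta) - 1)) = -(r / eta * v ^ (-(1 / eta) - 1)) by ring,
        abs_neg, abs_of_pos (by positivity)]
    have h3 : v ^ (-(1 / eta) - 1) * v ^ (-(1 / eta)) * v = v ^ (1 - 2 / eta - 1) := by
      nth_rewrite 3 [← Real.rpow_one v]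
      rw [← Real.rpow_add hv0, ← Real.rpow_add hv0]
      congr 1
      ring
    rw [h2, mul_assoc t, h1, ← h3, smul_eq_mul]
    simp only [hf]
    field_simp
  have hint : IntegrableOn (fun v : ℝ => r ^ 2 * (t / eta) * (v ^ (1 - 2 / eta - 1) * (1 + t * v)⁻¹))
      (Set.Ioo 0 1) := (integrableOn_rpow_mul_inv hb ht).const_mul _
  rw [← image_mul_rpow_Ioo hr he0]
  constructor
  · rw [integrableOn_image_iff_integrableOn_abs_deriv_smul measurableSet_Ioo hd hinj]
    exact hint.congr_fun (fun v hv => (hval v hv).symm) measurableSet_Ioo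
  · rw [integral_image_eq_integral_abs_deriv_smul measurableSet_Ioo hd hinj,
      setIntegral_congr_fun measurableSet_Ioo hval, integral_const_mul,
      show 2 - 2 / eta = 1 - 2 / eta + 1 by ring, gaussHypergeometric_one_add_one hb]
    simp only [neg_mul, sub_neg_eq_add]
    have : eta - 2 ≠ 0 := by linarith
    field_simp

open Classical in
/-- Loss in the Laplace functional that is due to a device at distance `r` from its own station,
integrated over its position. -/
theorem lintegral_interference {r t eta : ℝ} (hr : 0 ≤ r) (ht : 0 ≤ t) (heta : 2 < eta) :
    ∫⁻ y : Plane, (if r ^ eta * ‖y‖ ^ (-eta) < 1 then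
      ENNReal.ofReal (t * r ^ eta * ‖y‖ ^ (-eta) / (1 + t * r ^ eta * ‖y‖ ^ (-eta))) else 0) =
      ENNReal.ofReal (r ^ 2) * ENNReal.ofReal (Real.pi * (2 * t / (eta - 2) *
        gaussHypergeometric 1 (1 - 2 / eta) (2 - 2 / eta) (-t))) := by
  have he0 : 0 < eta := by linarith
  rcases hr.eq_or_lt with rfl | hr
  · simp [Real.zero_rpow he0.ne']
  set F : ℝ → ℝ := fun w => if r ^ eta * w ^ (-eta) < 1 then
    t * r ^ eta * w ^ (-eta) / (1 + t * r ^ eta * w ^ (-eta)) else 0 with hF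
  have hF0 : ∀ w, 0 ≤ w → 0 ≤ F w := fun w hw => by
    simp only [hF]
    split_ifs <;> positivity
  -- The association condition says that the device is farther from the origin than from its own
  -- station.
  have hcond : ∀ w, 0 < w → (r ^ eta * w ^ (-eta) < 1 ↔ w ∈ Set.Ioi r) := fun w hw => by
    rw [Real.rpow_neg hw.le, ← div_eq_mul_inv, div_lt_one (by positivity), Set.mem_Ioi]
    exact Real.rpow_lt_rpow_iff hr.le hw.le he0
  have hind : ∀ w ∈ Set.Ioi (0 : ℝ), w ^ (Module.finrank ℝ Plane - 1) • F w =
      (Set.Ioi r).indicator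
        (fun w => w * (t * r ^ eta * w ^ (-eta) / (1 + t * r ^ eta * w ^ (-eta)))) w := by
    intro w hw
    simp only [hF, hcond w hw, Set.indicator_apply]
    split_ifs <;> simp
  obtain ⟨hi, hv⟩ := integral_Ioi_interference hr ht heta
  have hsub : Set.Ioi r ⊆ Set.Ioi (0 : ℝ) := Set.Ioi_subset_Ioi hr.le
  have hint : Integrable (fun y : Plane => F ‖y‖) := by
    rw [integrable_fun_norm_addHaar]
    refine IntegrableOn.congr_fun ?_ (fun w hw => (hind w hw).symm) measurableSet_Ioi
    exact ((integrable_indicator_iff measurableSet_Ioi).2 hi).integrableOn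
  have hval : ∫ y : Plane, F ‖y‖ = r ^ 2 * (Real.pi * (2 * t / (eta - 2) *
      gaussHypergeometric 1 (1 - 2 / eta) (2 - 2 / eta) (-t))) := by
    -- Polar coordinates in dimension 2; the prefactor is twice the area of the unit disc, 2π.
    rw [integral_fun_norm_addHaar, setIntegral_congr_fun measurableSet_Ioi hind,
      setIntegral_indicator measurableSet_Ioi, Set.inter_eq_right.2 hsub, hv, measureReal_def,
      EuclideanSpace.volume_ball_fin_two]
    simp [Real.pi_pos.le]
    ring
  rw [← ENNReal.ofReal_mul (by positivity), ← hval,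
    ofReal_integral_eq_lintegral_ofReal hint
      (Filter.Eventually.of_forall fun y => hF0 _ (norm_nonneg y))]
  refine lintegral_congr fun y => ?_
  simp only [hF]
  split_ifs <;> simp

/-! ### Failure probabilities of the network -/

theorem voronoiShape_pos : 0 < voronoiShape := by norm_num [voronoiShape]

theorem gaussHypergeometric_nonneg {b t : ℝ} (hb : 0 < b) (ht : 0 ≤ t) :
    0 ≤ gaussHypergeometric 1 b (b + 1) (-t) := by
  rw [gaussHypergeometric_one_add_one hb]
  refine mul_nonneg hb.le (setIntegral_nonneg measurableSet_Ioo fun u hu => ?_)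
  have hu0 := hu.1
  rw [neg_mul, sub_neg_eq_add]
  positivity

/-! ### Closed-form factors -/

namespace RampingParams

variable {M : ℕ} (q : RampingParams M)

theorem eta_pos : 0 < q.eta := two_pos.trans q.two_lt_eta

theorem relThreshold_pos (m k : Fin M) : 0 < q.relThreshold m k :=
  div_pos (mul_pos q.theta_pos (q.rho_pos k)) (q.rho_pos m)

theorem gaussHypergeometric_relThreshold_nonneg (m k : Fin M) :
    0 ≤ gaussHypergeometric 1 (1 - 2 / q.eta) (2 - 2 / q.eta) (-q.relThreshold m k) := by
  have hb : 0 < 1 - 2 / q.eta := by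
    rw [sub_pos, div_lt_one q.eta_pos]; exact q.two_lt_eta
  have h := gaussHypergeometric_nonneg hb (q.relThreshold_pos m k).le
  rwa [show 1 - 2 / q.eta + 1 = 2 - 2 / q.eta by ring] at h

variable {q} {x : Fin M → ℝ}

theorem activeIntensity_nonneg (hx : ∀ k, 0 ≤ x k) (k : Fin M) : 0 ≤ q.activeIntensity x k :=
  mul_nonneg (hx k) q.U_pos.le

/-- This is the form in which the Gamma transform arises; the range and the continuity of the factor
are also read off from it. -/
theorem intraFactor_eq (hx : ∀ k, 0 ≤ x k) (m k : Fin M) :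
    q.intraFactor x m k = (voronoiShape * q.lam / (voronoiShape * q.lam +
      q.activeIntensity x k * (q.relThreshold m k / (1 + q.relThreshold m k)))) ^ voronoiShape := by
  have h1 := activeIntensity_nonneg (q := q) hx k
  have h2 := q.relThreshold_pos m k
  have h3 : 0 < voronoiShape * q.lam := mul_pos voronoiShape_pos q.lam_pos
  rw [intraFactor, cellParam]
  congr 1
  field_simp
  ring

theorem intraFactor_pos (hx : ∀ k, 0 ≤ x k) (m k : Fin M) : 0 < q.intraFactor x m k := by
  have h1 := activeIntensity_nonneg (q := q) hx k
  have h2 := q.relThreshold_pos m k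
  have h3 : 0 < voronoiShape * q.lam := mul_pos voronoiShape_pos q.lam_pos
  rw [intraFactor_eq hx]
  positivity

end RampingParams

/-! ### Sources of randomness and Laplace transforms of the interference -/

namespace RampingNetwork

variable {M : ℕ} {q : RampingParams M} {x : Fin M → ℝ} {Ω : Type*} [mΩ : MeasurableSpace Ω]
  {P : Measure Ω} (N : RampingNetwork q x P)

/-- Number and positions of the devices of level `k`. -/
def deviceConfig (k : Fin M) (ω : Ω) : ℕ∞ × (ℕ → Plane) :=
  ((N.devices k).num ω, fun i => (N.devices k).pt i ω)

/-- Serving distance and channel gain of an out-of-cell device. -/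
def mark (k : Fin M) (i : ℕ) (ω : Ω) : ℝ × ℝ := (N.servDist k i ω, N.interGain k i ω)

/-- The `σ`-algebra of a source of randomness. -/
@[reducible] def sourceSigma : Source M → MeasurableSpace Ω
  | .state => MeasurableSpace.comap N.state inferInstance
  | .gain => MeasurableSpace.comap N.gain inferInstance
  | .cellCount k => MeasurableSpace.comap (N.cellCount k) inferInstance
  | .intraGain k n => MeasurableSpace.comap (N.intraGain k n) inferInstance
  | .devices k => MeasurableSpace.comap (N.deviceConfig k) inferInstance
  | .servDist k i => MeasurableSpace.comap (N.servDist k i) inferInstance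
  | .interGain k i => MeasurableSpace.comap (N.interGain k i) inferInstance

theorem iIndep_sourceSigma : iIndep N.sourceSigma P := by
  have h := N.indep
  convert h using 2 with s
  cases s <;> rfl

theorem measurable_deviceConfig (k : Fin M) : Measurable (N.deviceConfig k) :=
  (N.devices k).measurable_num.prodMk (measurable_pi_lambda _ (N.devices k).measurable_pt)

theorem measurable_mark (k : Fin M) (i : ℕ) : Measurable (N.mark k i) :=
  (N.measurable_servDist k i).prodMk (N.measurable_interGain k i)

theorem sourceSigma_le : ∀ s, N.sourceSigma s ≤ mΩ
  | .state => N.measurable_state.comap_le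
  | .gain => N.measurable_gain.comap_le
  | .cellCount k => (N.measurable_cellCount k).comap_le
  | .intraGain k n => (N.measurable_intraGain k n).comap_le
  | .devices k => (N.measurable_deviceConfig k).comap_le
  | .servDist k i => (N.measurable_servDist k i).comap_le
  | .interGain k i => (N.measurable_interGain k i).comap_le

/-- Measurability is tracked relative to sets of sources, so that independence of derived quantities
reduces to disjointness of the sets they use. -/
theorem measurable_iSup_of_mem {β : Type*} [mβ : MeasurableSpace β] {f : Ω → β} {s : Source M}
    (hf : N.sourceSigma s = mβ.comap f) {S : Set (Source M)} (hs : s ∈ S) :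
    Measurable[⨆ i ∈ S, N.sourceSigma i] f :=
  Measurable.mono (comap_measurable f) (hf ▸ le_biSup N.sourceSigma hs) le_rfl

/-- Received interference of an out-of-cell device of level `k` as a function of its mark and its
position. -/
def recvPower (q : RampingParams M) (k : Fin M) (z : (ℝ × ℝ) × Plane) : ℝ≥0∞ :=
  {z : (ℝ × ℝ) × Plane | q.rho k * z.1.1 ^ q.eta * ‖z.2‖ ^ (-q.eta) < q.rho k}.indicator
    (fun z => ENNReal.ofReal (q.rho k * z.1.1 ^ q.eta * z.1.2 * ‖z.2‖ ^ (-q.eta))) z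

theorem measurable_recvPower (q : RampingParams M) (k : Fin M) : Measurable (recvPower q k) := by
  refine Measurable.indicator (by fun_prop) (measurableSet_lt (by fun_prop) (by fun_prop))

theorem interInterference_eq (k : Fin M) (ω : Ω) : N.interInterference k ω =
    markedSum (recvPower q k) (N.deviceConfig k ω, fun i => N.mark k i ω) := by
  rw [interInterference, markedSum]
  refine tsum_congr fun i => ?_
  simp only [Set.indicator_apply, recvPower, mark, power, deviceConfig, Set.mem_ofPred_eq]
  by_cases h1 : (i : ℕ∞) < (N.devices k).num ω <;>
    by_cases h2 : q.rho k * N.servDist k i ω ^ q.eta * ‖(N.devices k).pt i ω‖ ^ (-q.eta) < q.rho k <;>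
      simp only [h1, h2, and_self, and_true, and_false, if_true, if_false]

theorem measurable_intraInterference_of_mem {S : Set (Source M)} {k : Fin M}
    (h1 : .cellCount k ∈ S) (h2 : ∀ n, .intraGain k n ∈ S) :
    Measurable[⨆ i ∈ S, N.sourceSigma i] (N.intraInterference k) := by
  have hφ : Measurable fun w : ℕ × (ℕ → ℝ) =>
      ∑ n ∈ Finset.range w.1, ENNReal.ofReal (q.rho k * w.2 n) :=
    measurable_from_prod_countable_right fun n =>
      Finset.measurable_sum (Finset.range n)
        (f := fun i (y : ℕ → ℝ) => ENNReal.ofReal (q.rho k * y i)) fun i _ => by fun_prop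
  exact hφ.comp ((N.measurable_iSup_of_mem rfl h1).prodMk
    (measurable_pi_of_measurable fun n => N.measurable_iSup_of_mem rfl (h2 n)))

theorem measurable_mark_of_mem {S : Set (Source M)} {k : Fin M} {i : ℕ}
    (h1 : .servDist k i ∈ S) (h2 : .interGain k i ∈ S) :
    Measurable[⨆ i ∈ S, N.sourceSigma i] (N.mark k i) :=
  (N.measurable_iSup_of_mem (s := .servDist k i) rfl h1).prodMk
    (N.measurable_iSup_of_mem (s := .interGain k i) rfl h2)

theorem measurable_interInterference_of_mem {S : Set (Source M)} {k : Fin M}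
    (h1 : .devices k ∈ S) (h2 : ∀ i, .servDist k i ∈ S) (h3 : ∀ i, .interGain k i ∈ S) :
    Measurable[⨆ i ∈ S, N.sourceSigma i] (N.interInterference k) := by
  rw [funext (N.interInterference_eq k)]
  exact (measurable_markedSum (measurable_recvPower q k)).comp
    ((N.measurable_iSup_of_mem rfl h1).prodMk
      (measurable_pi_of_measurable fun i => N.measurable_mark_of_mem (h2 i) (h3 i)))

/-- Laplace transform of the intra-cell interference. -/
theorem lintegral_expNeg_intraInterference [IsProbabilityMeasure P] (hx : ∀ k, 0 ≤ x k)
    (m k : Fin M) :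
    ∫⁻ ω, expNeg (ENNReal.ofReal (q.theta / q.rho m) * N.intraInterference k ω) ∂P =
      ENNReal.ofReal (q.intraFactor x m k) := by
  have hθ := q.theta_pos
  have hρ := q.rho_pos
  have hs : 0 ≤ q.theta / q.rho m := (div_pos hθ (hρ m)).le
  have ht := q.relThreshold_pos m k
  have hrel : q.theta / q.rho m * q.rho k = q.relThreshold m k := by
    rw [RampingParams.relThreshold]; ring
  have hexp : ∀ ω, expNeg (ENNReal.ofReal (q.theta / q.rho m) * N.intraInterference k ω) =
      ∏ n ∈ Finset.range (N.cellCount k ω),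
        expNeg (ENNReal.ofReal (q.relThreshold m k * N.intraGain k n ω)) := fun ω => by
    rw [intraInterference, Finset.mul_sum, expNeg_sum]
    refine Finset.prod_congr rfl fun n _ => ?_
    rw [← ENNReal.ofReal_mul hs, ← mul_assoc, hrel]
  have hF : Measurable fun g : ℝ => expNeg (ENNReal.ofReal (q.relThreshold m k * g)) :=
    measurable_expNeg.comp (by fun_prop)
  have hz : ∀ n, ∫⁻ ω, expNeg (ENNReal.ofReal (q.relThreshold m k * N.intraGain k n ω)) ∂P =
      ENNReal.ofReal (1 / (1 + q.relThreshold m k)) := fun n => by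
    rw [← lintegral_map hF (N.measurable_intraGain k n), N.law_intraGain,
      lintegral_expNeg_expMeasure ht.le]
  have hI : iIndepFun (N.intraGain k) P :=
    iIndepFun_of_measurable_iSup N.sourceSigma_le N.iIndep_sourceSigma
      (S := fun n => {Source.intraGain k n}) (fun a b hab => by simpa using hab)
      fun n => N.measurable_iSup_of_mem rfl (Set.mem_singleton _)
  have hNY : IndepFun (N.cellCount k) (fun ω n => N.intraGain k n ω) P :=
    indepFun_of_measurable_iSup N.sourceSigma_le N.iIndep_sourceSigma
      (S := {Source.cellCount k}) (T := Set.range (Source.intraGain k)) (by simp)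
      (N.measurable_iSup_of_mem rfl (Set.mem_singleton _))
      (measurable_pi_of_measurable fun n => N.measurable_iSup_of_mem rfl (Set.mem_range_self n))
  simp_rw [hexp]
  rw [lintegral_prod_range_of_indepFun (N.measurable_cellCount k) (N.measurable_intraGain k) hNY hI
    hF hz, N.law_cellCount, lintegral_pow_cellCountLaw q.lam_pos
    (RampingParams.activeIntensity_nonneg hx k) ht.le, RampingParams.intraFactor_eq hx]

theorem identDistrib_servDist (k : Fin M) (i j : ℕ) :
    IdentDistrib (N.servDist k i) (N.servDist k j) P P :=
  (N.law_servDist k i).trans (N.law_servDist k j).symm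

theorem ae_servDist_nonneg (k : Fin M) (i : ℕ) : ∀ᵐ ω ∂P, 0 ≤ N.servDist k i ω :=
  (N.law_servDist k i).symm.ae_snd (p := fun r => 0 ≤ r) measurableSet_Ici
    (Filter.Eventually.of_forall fun ω => N.stations.distToOrigin_nonneg ω)

theorem lintegral_servDist_sq (k : Fin M) (i : ℕ) :
    ∫⁻ ω, ENNReal.ofReal (N.servDist k i ω ^ 2) ∂P = ENNReal.ofReal (1 / (q.lam * Real.pi)) := by
  have hid := N.law_servDist k i
  -- Almost everywhere measurability of the distance to the stations is part of `IdentDistrib`.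
  rw [← N.law_stations.lintegral_distToOrigin_sq q.lam_pos hid.aemeasurable_snd]
  exact (hid.comp (u := fun r : ℝ => ENNReal.ofReal (r ^ 2)) (by fun_prop)).lintegral_eq

theorem indepFun_servDist_interGain (k : Fin M) (i : ℕ) :
    IndepFun (N.servDist k i) (N.interGain k i) P :=
  indepFun_of_measurable_iSup N.sourceSigma_le N.iIndep_sourceSigma
    (S := {Source.servDist k i}) (T := {Source.interGain k i}) (by simp)
    (N.measurable_iSup_of_mem rfl (Set.mem_singleton _))
    (N.measurable_iSup_of_mem rfl (Set.mem_singleton _))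

open Classical in
/-- Laplace transform of the received interference of a device at distance `r` from its own station
and at position `y`, averaged over its channel gain. -/
def gainAverage (eta t : ℝ) (z : ℝ × Plane) : ℝ≥0∞ :=
  if z.1 ^ eta * ‖z.2‖ ^ (-eta) < 1 then
    ENNReal.ofReal (1 / (1 + t * z.1 ^ eta * ‖z.2‖ ^ (-eta))) else 1

theorem measurable_gainAverage (eta t : ℝ) : Measurable (gainAverage eta t) :=
  Measurable.ite (measurableSet_lt (by fun_prop) (by fun_prop)) (by fun_prop) measurable_const

open Classical in
theorem one_sub_gainAverage {eta t r : ℝ} (ht : 0 ≤ t) (hr : 0 ≤ r) (y : Plane) :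
    1 - gainAverage eta t (r, y) = if r ^ eta * ‖y‖ ^ (-eta) < 1 then
      ENNReal.ofReal (t * r ^ eta * ‖y‖ ^ (-eta) / (1 + t * r ^ eta * ‖y‖ ^ (-eta))) else 0 := by
  have hK : 0 ≤ t * r ^ eta * ‖y‖ ^ (-eta) := by positivity
  simp only [gainAverage]
  split_ifs
  · rw [← ENNReal.ofReal_one, ← ENNReal.ofReal_sub _ (by positivity)]
    congr 1
    field_simp
    ring
  · simp

theorem gainAverage_le_one {eta t r : ℝ} (ht : 0 ≤ t) (hr : 0 ≤ r) (y : Plane) :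
    gainAverage eta t (r, y) ≤ 1 := by
  have hK : 0 ≤ t * r ^ eta * ‖y‖ ^ (-eta) := by positivity
  simp only [gainAverage]
  split_ifs
  · rw [ENNReal.ofReal_le_one]
    exact div_le_one_of_le₀ (by linarith) (by positivity)
  · exact le_rfl

/-- The gain is averaged first, with the serving distance frozen. Equality in law of the serving
distances then replaces `i` by 0, so the average depends on the position only, as the marked Laplace
functional requires. -/
theorem lintegral_expNeg_recvPower [IsProbabilityMeasure P] (m k : Fin M) (i : ℕ) (y : Plane) :
    ∫⁻ ω, expNeg (ENNReal.ofReal (q.theta / q.rho m) * recvPower q k (N.mark k i ω, y)) ∂P =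
      ∫⁻ ω, gainAverage q.eta (q.relThreshold m k) (N.servDist k 0 ω, y) ∂P := by
  have hρ := q.rho_pos k
  have hs : 0 ≤ q.theta / q.rho m := (div_pos q.theta_pos (q.rho_pos m)).le
  have ht := q.relThreshold_pos m k
  have hrel : q.theta / q.rho m * q.rho k = q.relThreshold m k := by
    rw [RampingParams.relThreshold]; ring
  have hφ : Measurable fun z : ℝ × ℝ =>
      expNeg (ENNReal.ofReal (q.theta / q.rho m) * recvPower q k (z, y)) :=
    measurable_expNeg.comp
      (((measurable_recvPower q k).comp (measurable_id.prodMk measurable_const)).const_mul _)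
  have h1 := lintegral_comp_prodMk_of_indepFun (N.measurable_servDist k i)
    (N.measurable_interGain k i) (N.indepFun_servDist_interGain k i) hφ
  have hG : Measurable fun r : ℝ => gainAverage q.eta (q.relThreshold m k) (r, y) :=
    (measurable_gainAverage _ _).comp (measurable_id.prodMk measurable_const)
  refine h1.trans (Eq.trans ?_ ((N.identDistrib_servDist k i 0).comp hG).lintegral_eq)
  refine lintegral_congr_ae ?_
  filter_upwards [N.ae_servDist_nonneg k i] with ω hr
  simp only [Function.comp_apply]
  generalize N.servDist k i ω = r at hr
  have hK : 0 ≤ q.relThreshold m k * r ^ q.eta * ‖y‖ ^ (-q.eta) := by positivity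
  have hcond : q.rho k * r ^ q.eta * ‖y‖ ^ (-q.eta) < q.rho k ↔ r ^ q.eta * ‖y‖ ^ (-q.eta) < 1 := by
    rw [mul_assoc]
    exact mul_lt_iff_lt_one_right hρ
  by_cases hc : r ^ q.eta * ‖y‖ ^ (-q.eta) < 1
  · have h2 : ∀ h, expNeg (ENNReal.ofReal (q.theta / q.rho m) * recvPower q k ((r, h), y)) =
        expNeg (ENNReal.ofReal (q.relThreshold m k * r ^ q.eta * ‖y‖ ^ (-q.eta) * h)) := fun h => by
      rw [recvPower, Set.indicator_of_mem (by exact hcond.2 hc), ← ENNReal.ofReal_mul hs, ← hrel]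
      ring_nf
    simp only [h2, gainAverage, hc, if_true]
    have hm : Measurable fun h : ℝ =>
        expNeg (ENNReal.ofReal (q.relThreshold m k * r ^ q.eta * ‖y‖ ^ (-q.eta) * h)) :=
      measurable_expNeg.comp (by fun_prop)
    rw [← lintegral_expNeg_expMeasure hK, ← N.law_interGain k i,
      lintegral_map hm (N.measurable_interGain k i)]
  · have h2 : ∀ h, recvPower q k ((r, h), y) = 0 := fun h =>
      Set.indicator_of_notMem (by exact fun hh => hc (hcond.1 hh)) _
    simp [h2, gainAverage, hc, expNeg_zero]

/-- Laplace transform of the inter-cell interference. -/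
theorem lintegral_expNeg_interInterference [IsProbabilityMeasure P] (hx : ∀ k, 0 ≤ x k)
    (m k : Fin M) :
    ∫⁻ ω, expNeg (ENNReal.ofReal (q.theta / q.rho m) * N.interInterference k ω) ∂P =
      ENNReal.ofReal (q.interFactor x m k) := by
  have ht := q.relThreshold_pos m k
  have hu := RampingParams.activeIntensity_nonneg (q := q) hx k
  have hF := q.gaussHypergeometric_relThreshold_nonneg m k
  have hlam := q.lam_pos
  have heta : 0 < q.eta - 2 := sub_pos.2 q.two_lt_eta
  have hI : iIndepFun (N.mark k) P :=
    iIndepFun_of_measurable_iSup N.sourceSigma_le N.iIndep_sourceSigma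
      (S := fun i => {Source.servDist k i, Source.interGain k i})
      (fun a b hab => by simp [hab.symm]) fun n =>
        N.measurable_mark_of_mem (Set.mem_insert _ _)
          (Set.mem_insert_of_mem _ (Set.mem_singleton _))
  have hNY : IndepFun (N.deviceConfig k) (fun ω i => N.mark k i ω) P :=
    indepFun_of_measurable_iSup N.sourceSigma_le N.iIndep_sourceSigma
      (S := {Source.devices k})
      (T := Set.range (Source.servDist k) ∪ Set.range (Source.interGain k)) (by simp)
      (N.measurable_iSup_of_mem rfl (Set.mem_singleton _))
      (measurable_pi_of_measurable fun i =>
        N.measurable_mark_of_mem (Or.inl (Set.mem_range_self i)) (Or.inr (Set.mem_range_self i)))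
  simp_rw [interInterference_eq, const_mul_markedSum]
  have hGm : Measurable fun w : Plane × Ω =>
      gainAverage q.eta (q.relThreshold m k) (N.servDist k 0 w.2, w.1) :=
    (measurable_gainAverage _ _).comp
      (((N.measurable_servDist k 0).comp measurable_snd).prodMk measurable_fst)
  refine ((N.law_devices k).lintegral_expNeg_markedSum (N.measurable_mark k) hNY hI
    ((measurable_recvPower q k).const_mul _) (N.lintegral_expNeg_recvPower m k)).trans ?_
  have h1 : ∀ y : Plane,
      1 - ∫⁻ ω, gainAverage q.eta (q.relThreshold m k) (N.servDist k 0 ω, y) ∂P =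
      ∫⁻ ω, (1 - gainAverage q.eta (q.relThreshold m k) (N.servDist k 0 ω, y)) ∂P := fun y => by
    have hle : ∀ᵐ ω ∂P, gainAverage q.eta (q.relThreshold m k) (N.servDist k 0 ω, y) ≤ 1 := by
      filter_upwards [N.ae_servDist_nonneg k 0] with ω hr
      exact gainAverage_le_one ht.le hr y
    have hm : Measurable fun ω => gainAverage q.eta (q.relThreshold m k) (N.servDist k 0 ω, y) :=
      hGm.comp measurable_prodMk_left
    rw [lintegral_sub hm _ hle]
    · simp
    · exact ((lintegral_mono_ae hle).trans_lt (by simp)).ne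
  have h2 : ∫⁻ y : Plane, (1 - ∫⁻ ω, gainAverage q.eta (q.relThreshold m k)
      (N.servDist k 0 ω, y) ∂P) = ENNReal.ofReal (1 / (q.lam * Real.pi)) *
      ENNReal.ofReal (Real.pi * (2 * q.relThreshold m k / (q.eta - 2) *
        gaussHypergeometric 1 (1 - 2 / q.eta) (2 - 2 / q.eta) (-q.relThreshold m k))) := by
    simp_rw [h1]
    -- Tonelli: integrating over the position first gives a constant times r², so only the second
    -- moment of the serving distance is needed.
    rw [lintegral_lintegral_swap (hGm.const_sub 1).aemeasurable, ← N.lintegral_servDist_sq k 0,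
      ← lintegral_mul_const _ (by have := N.measurable_servDist k 0; fun_prop)]
    refine lintegral_congr_ae ?_
    filter_upwards [N.ae_servDist_nonneg k 0] with ω hr
    rw [← lintegral_interference hr ht.le q.two_lt_eta]
    exact lintegral_congr fun y => one_sub_gainAverage ht.le hr y
  rw [h2, ← ENNReal.ofReal_mul (by positivity), ← ENNReal.ofReal_mul hu,
    expNeg_ofReal (by positivity), RampingParams.interFactor]
  congr 3
  field_simp

/-- The level and the kind (intra-cell or inter-cell) of the interference that a source feeds. -/
def interferer : Source M → Option (Fin M ⊕ Fin M)
  | .state => none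
  | .gain => none
  | .cellCount k => some (.inl k)
  | .intraGain k _ => some (.inl k)
  | .devices k => some (.inr k)
  | .servDist k _ => some (.inr k)
  | .interGain k _ => some (.inr k)

/-- The interference components of the network. -/
def interference (j : Fin M ⊕ Fin M) : Ω → ℝ≥0∞ :=
  Sum.elim N.intraInterference N.interInterference j

theorem measurable_interference_of_mem {S : Set (Source M)} {j : Fin M ⊕ Fin M}
    (hS : ∀ s, interferer s = some j → s ∈ S) :
    Measurable[⨆ i ∈ S, N.sourceSigma i] (N.interference j) := by
  rcases j with k | k
  · exact N.measurable_intraInterference_of_mem (hS _ rfl) fun n => hS _ rfl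
  · exact N.measurable_interInterference_of_mem (hS _ rfl) (fun i => hS _ rfl) fun i => hS _ rfl

/-- Noise plus interference. -/
def noisePlusInterference (ω : Ω) : ℝ≥0∞ :=
  ENNReal.ofReal (q.sigma ^ 2) + ∑ j, N.interference j ω

theorem sinr_eq (m : Fin M) (ω : Ω) :
    N.sinr m ω = ENNReal.ofReal (q.rho m * N.gain ω) / N.noisePlusInterference ω := by
  rw [sinr, noisePlusInterference, Fintype.sum_sum_type, add_assoc]
  rfl

theorem measurable_noisePlusInterference_of_mem {S : Set (Source M)}
    (hS : ∀ s, (interferer s).isSome → s ∈ S) :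
    Measurable[⨆ i ∈ S, N.sourceSigma i] N.noisePlusInterference :=
  Measurable.const_add (Finset.measurable_sum _ fun j _ =>
    N.measurable_interference_of_mem fun s hs => hS s (by simp [hs])) _

theorem lintegral_expNeg_noisePlusInterference [IsProbabilityMeasure P] (hx : ∀ k, 0 ≤ x k)
    (m : Fin M) :
    ∫⁻ ω, expNeg (ENNReal.ofReal (q.theta / q.rho m) * N.noisePlusInterference ω) ∂P =
      ENNReal.ofReal (1 - q.failProb x m) := by
  have hs : 0 ≤ q.theta / q.rho m := (div_pos q.theta_pos (q.rho_pos m)).le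
  simp_rw [noisePlusInterference, mul_add, expNeg_add, Finset.mul_sum, expNeg_sum]
  have hm : ∀ j, Measurable[⨆ i ∈ {s | interferer s = some j}, N.sourceSigma i]
      fun ω => expNeg (ENNReal.ofReal (q.theta / q.rho m) * N.interference j ω) := fun j =>
    measurable_expNeg.comp ((N.measurable_interference_of_mem fun s hs => hs).const_mul _)
  have hm' : ∀ j, Measurable
      fun ω => expNeg (ENNReal.ofReal (q.theta / q.rho m) * N.interference j ω) := fun j =>
    (hm j).mono (iSup₂_le fun s _ => N.sourceSigma_le s) le_rfl
  rw [lintegral_const_mul _ (Finset.measurable_prod _ fun j _ => hm' j),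
    lintegral_prod_of_iIndep N.sourceSigma_le N.iIndep_sourceSigma _ hm, Fintype.prod_sum_type]
  · have h1 : ∀ k, 0 ≤ q.interFactor x m k := fun k => (Real.exp_pos _).le
    have h2 : ∀ k, 0 ≤ q.intraFactor x m k := fun k => (RampingParams.intraFactor_pos hx m k).le
    simp only [interference, Sum.elim_inl, Sum.elim_inr, N.lintegral_expNeg_intraInterference hx,
      N.lintegral_expNeg_interInterference hx]
    rw [← ENNReal.ofReal_prod_of_nonneg fun k _ => h2 k,
      ← ENNReal.ofReal_prod_of_nonneg fun k _ => h1 k, ← ENNReal.ofReal_mul hs,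
      expNeg_ofReal (by positivity), ← ENNReal.ofReal_mul (Finset.prod_nonneg fun k _ => h2 k),
      ← ENNReal.ofReal_mul (Real.exp_pos _).le, RampingParams.failProb, Finset.prod_mul_distrib,
      sub_sub_cancel]
    ring_nf
  -- `interferer` assigns each source at most one component, so its fibres are disjoint.
  · intro a b hab
    rw [Set.disjoint_left]
    intro s hs hs'
    exact hab (Option.some_injective _ (Eq.trans (Eq.symm hs) hs'))

/-- At a fixed level the SINR does not involve the state, which makes this event independent of the
state. -/
theorem measurableSet_failAt_of_mem {S : Set (Source M)} (hS : ∀ s, s ≠ .state → s ∈ S)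
    (m : Fin M) : MeasurableSet[⨆ i ∈ S, N.sourceSigma i] (N.failAt m) := by
  have h1 : Measurable[⨆ i ∈ S, N.sourceSigma i] N.gain :=
    N.measurable_iSup_of_mem (s := .gain) rfl (hS _ (by simp))
  have h2 := N.measurable_noisePlusInterference_of_mem (S := S) fun s hs => hS s (by
    rintro rfl
    simp [interferer] at hs)
  simp only [failAt, sinr_eq]
  exact measurableSet_lt (((h1.const_mul _).ennreal_ofReal).div h2) measurable_const

theorem measurableSet_failAt (m : Fin M) : MeasurableSet (N.failAt m) :=
  iSup₂_le (fun s _ => N.sourceSigma_le s) _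
    (N.measurableSet_failAt_of_mem (S := Set.univ) (fun _ _ => Set.mem_univ _) m)

theorem measureReal_failAt [IsProbabilityMeasure P] (hx : ∀ k, 0 ≤ x k) (m : Fin M) :
    P.real (N.failAt m) = q.failProb x m := by
  have hle : ∀ s, N.sourceSigma s ≤ mΩ := N.sourceSigma_le
  have hI : Measurable N.noisePlusInterference :=
    (N.measurable_noisePlusInterference_of_mem (S := Set.univ) fun _ _ => Set.mem_univ _).mono
      (iSup₂_le fun s _ => hle s) le_rfl
  have hind : IndepFun N.noisePlusInterference N.gain P :=
    indepFun_of_measurable_iSup hle N.iIndep_sourceSigma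
      (S := {s | (interferer s).isSome}) (T := {Source.gain}) (by simp [interferer])
      (N.measurable_noisePlusInterference_of_mem fun s hs => hs)
      (N.measurable_iSup_of_mem rfl (Set.mem_singleton _))
  have h := measure_le_div_of_exp N.measurable_gain hI N.law_gain hind (q.rho_pos m) q.theta_pos
  rw [N.lintegral_expNeg_noisePlusInterference hx] at h
  have hc : {ω | ENNReal.ofReal q.theta ≤
      ENNReal.ofReal (q.rho m * N.gain ω) / N.noisePlusInterference ω} = (N.failAt m)ᶜ := by
    ext ω
    simp [failAt, sinr_eq]
  have hnn : 0 ≤ 1 - q.failProb x m := by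
    rw [RampingParams.failProb, sub_sub_cancel]
    exact mul_nonneg (Real.exp_pos _).le (Finset.prod_nonneg fun k _ =>
      mul_nonneg (RampingParams.intraFactor_pos hx m k).le (Real.exp_pos _).le)
  rw [hc] at h
  have h2 := probReal_compl_eq_one_sub (μ := P) (N.measurableSet_failAt m)
  rw [measureReal_def, h, ENNReal.toReal_ofReal hnn] at h2
  linarith

theorem measureReal_state_eq (hx : ∀ k, 0 ≤ x k) (m : Fin M) :
    P.real {ω | N.state ω = m} = x m := by
  rw [measureReal_def, N.law_state, ENNReal.toReal_ofReal (hx m)]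

theorem measurableSet_state_eq (m : Fin M) : MeasurableSet {ω | N.state ω = m} :=
  N.measurable_state (measurableSet_singleton m)

/-- On `{S = m}` failure is failure at level `m`, and that event is independent of the state. No
conditioning is used, so levels of probability zero are included. -/
theorem measureReal_state_inter_fail [IsProbabilityMeasure P] (hx : ∀ k, 0 ≤ x k) (m : Fin M) :
    P.real ({ω | N.state ω = m} ∩ N.fail) = x m * q.failProb x m := by
  have h1 : {ω | N.state ω = m} ∩ N.fail = {ω | N.state ω = m} ∩ N.failAt m := by
    ext ω
    simp only [Set.mem_inter_iff, Set.mem_ofPred_eq, fail, failAt]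
    refine and_congr_right fun h => ?_
    rw [h]
  have hind := indep_iSup_of_disjoint N.sourceSigma_le N.iIndep_sourceSigma
    (S := {Source.state}) (T := {s | s ≠ Source.state}) (by simp)
  have h2 := (Indep_iff _ _ P).1 hind _ _
    ((N.measurable_iSup_of_mem (s := .state) rfl (Set.mem_singleton _)) (measurableSet_singleton m))
    (N.measurableSet_failAt_of_mem (fun s hs => hs) m)
  rw [h1, ← N.measureReal_failAt hx, ← N.measureReal_state_eq hx m, measureReal_def, measureReal_def,
    measureReal_def, ← ENNReal.toReal_mul]
  exact congrArg ENNReal.toReal h2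

theorem cond_measureReal_fail [IsProbabilityMeasure P] (hx : ∀ k, 0 ≤ x k) {m : Fin M}
    (hm : 0 < x m) : (P[|{ω | N.state ω = m}]).real N.fail = q.failProb x m := by
  rw [measureReal_def, cond_apply (N.measurableSet_state_eq m), ENNReal.toReal_mul,
    ENNReal.toReal_inv, ← measureReal_def, ← measureReal_def, N.measureReal_state_inter_fail hx,
    N.measureReal_state_eq hx]
  field_simp

theorem measureReal_fail [IsProbabilityMeasure P] (hx : ∀ k, 0 ≤ x k) :
    P.real N.fail = ∑ m, x m * q.failProb x m := by
  simp_rw [← N.measureReal_state_inter_fail hx]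
  have h := sum_measure_preimage_singleton (μ := P.restrict N.fail) (f := N.state) Finset.univ
    fun m _ => N.measurableSet_state_eq m
  simp only [Finset.coe_univ, Set.preimage_univ, Measure.restrict_apply MeasurableSet.univ,
    Set.univ_inter] at h
  simp only [measureReal_def]
  rw [← h, ENNReal.toReal_sum fun m _ => measure_ne_top _ _]
  refine Finset.sum_congr rfl fun m _ => ?_
  rw [Measure.restrict_apply (N.measurable_state (measurableSet_singleton m))]
  rfl

end RampingNetwork

/-! ### The case `η = 4` -/

/-- The antiderivative 2/√t · arctan √(tu) is continuous up to 0, although the integrand is singular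
there for u^(-1/2). -/
theorem integral_rpow_mul_inv_eq_arctan {t : ℝ} (ht : 0 < t) :
    ∫ u in Set.Ioo (0 : ℝ) 1, u ^ ((1 / 2 : ℝ) - 1) * (1 + t * u)⁻¹ =
      2 / √t * Real.arctan √t := by
  rw [← integral_Ioc_eq_integral_Ioo, ← intervalIntegral.integral_of_le zero_le_one,
    intervalIntegral.integral_eq_sub_of_hasDerivAt_of_le zero_le_one
      (f := fun u => 2 / √t * Real.arctan √(t * u))]
  · simp
  · fun_prop
  · intro u hu
    have hu0 := hu.1
    have htu : 0 < t * u := by positivity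
    have h1 : HasDerivAt (fun u : ℝ => √(t * u)) (t * 1 / (2 * √(t * u))) u :=
      ((hasDerivAt_id u).const_mul t).sqrt htu.ne'
    convert! (h1.arctan).const_mul (2 / √t) using 1
    have h2 : u ^ ((1 / 2 : ℝ) - 1) = (√u)⁻¹ := by
      rw [Real.sqrt_eq_rpow, ← Real.rpow_neg hu0.le]
      norm_num
    have h3 := Real.sqrt_pos.2 ht
    have h4 := Real.sqrt_pos.2 hu0
    rw [h2, Real.sq_sqrt htu.le, Real.sqrt_mul ht.le]
    field_simp
    rw [Real.sq_sqrt ht.le]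
  · rw [intervalIntegrable_iff_integrableOn_Ioc_of_le zero_le_one, integrableOn_Ioc_iff_integrableOn_Ioo]
    exact integrableOn_rpow_mul_inv (by norm_num) ht.le

namespace RampingParams

variable {M : ℕ} {q : RampingParams M} {x : Fin M → ℝ}

theorem interFactor_of_eta_eq_four (h4 : q.eta = 4) (m k : Fin M) :
    q.interFactor x m k = Real.exp (-(q.activeIntensity x k / q.lam * √(q.relThreshold m k) *
      Real.arctan √(q.relThreshold m k))) := by
  have ht := q.relThreshold_pos m k
  have hs := Real.sqrt_pos.2 ht
  have hlam := q.lam_pos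
  rw [interFactor, h4, show (2 : ℝ) - 2 / 4 = 1 / 2 + 1 by norm_num,
    show (1 : ℝ) - 2 / 4 = 1 / 2 by norm_num, gaussHypergeometric_one_add_one (by norm_num)]
  simp only [neg_mul, sub_neg_eq_add]
  rw [integral_rpow_mul_inv_eq_arctan ht]
  congr 2
  field_simp
  rw [Real.sq_sqrt ht.le]
  ring

/-! ### Range and continuity of the failure probabilities -/

theorem interFactor_le_one (hx : ∀ k, 0 ≤ x k) (m k : Fin M) : q.interFactor x m k ≤ 1 := by
  have h1 := activeIntensity_nonneg (q := q) hx k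
  have h2 := q.relThreshold_pos m k
  have h3 := q.gaussHypergeometric_relThreshold_nonneg m k
  have h4 := q.lam_pos
  have h5 : 0 < q.eta - 2 := sub_pos.2 q.two_lt_eta
  rw [interFactor, Real.exp_le_one_iff, neg_nonpos]
  positivity

theorem intraFactor_le_one (hx : ∀ k, 0 ≤ x k) (m k : Fin M) : q.intraFactor x m k ≤ 1 := by
  have h1 := activeIntensity_nonneg (q := q) hx k
  have h2 := q.relThreshold_pos m k
  have h3 : 0 < voronoiShape * q.lam := mul_pos voronoiShape_pos q.lam_pos
  have h4 : 0 ≤ q.activeIntensity x k * (q.relThreshold m k / (1 + q.relThreshold m k)) := by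
    positivity
  rw [intraFactor_eq hx]
  exact Real.rpow_le_one (by positivity) (div_le_one_of_le₀ (by linarith) (by positivity))
    voronoiShape_pos.le

theorem intraFactor_lt_one (hx : ∀ k, 0 ≤ x k) (m : Fin M) {k : Fin M} (hk : 0 < x k) :
    q.intraFactor x m k < 1 := by
  have h1 : 0 < q.activeIntensity x k := mul_pos hk q.U_pos
  have h2 := q.relThreshold_pos m k
  have h3 : 0 < voronoiShape * q.lam := mul_pos voronoiShape_pos q.lam_pos
  have h4 : 0 < q.activeIntensity x k * (q.relThreshold m k / (1 + q.relThreshold m k)) := by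
    positivity
  rw [intraFactor_eq hx]
  exact Real.rpow_lt_one (by positivity) ((div_lt_one (by positivity)).2 (by linarith))
    voronoiShape_pos

theorem failProb_lt_one (hx : ∀ k, 0 ≤ x k) (m : Fin M) : q.failProb x m < 1 := by
  rw [failProb, sub_lt_self_iff]
  exact mul_pos (Real.exp_pos _) (Finset.prod_pos fun k _ =>
    mul_pos (intraFactor_pos hx m k) (Real.exp_pos _))

theorem failProb_pos (hx : x ∈ stdSimplex ℝ (Fin M)) (m : Fin M) : 0 < q.failProb x m := by
  -- The noise may vanish, so strictness comes from an occupied level, whose intra-cell factor is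
  -- below 1.
  obtain ⟨k, hk⟩ : ∃ k, 0 < x k := by
    by_contra! h
    linarith [hx.2, Finset.sum_nonpos fun k (_ : k ∈ Finset.univ) => h k]
  have hprod : ∏ k, q.intraFactor x m k * q.interFactor x m k < 1 := by
    have h0 : ∀ k, 0 < q.intraFactor x m k * q.interFactor x m k := fun k =>
      mul_pos (intraFactor_pos hx.1 m k) (Real.exp_pos _)
    rw [← Finset.mul_prod_erase _ _ (Finset.mem_univ k)]
    have h1 : ∏ j ∈ Finset.univ.erase k, q.intraFactor x m j * q.interFactor x m j ≤ 1 :=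
      Finset.prod_le_one (fun j _ => (h0 j).le) fun j _ =>
        mul_le_one₀ (intraFactor_le_one hx.1 m j) (Real.exp_pos _).le (interFactor_le_one hx.1 m j)
    have h2 : q.intraFactor x m k * q.interFactor x m k < 1 :=
      mul_lt_one_of_nonneg_of_lt_one_left (intraFactor_pos hx.1 m k).le
        (intraFactor_lt_one hx.1 m hk) (interFactor_le_one hx.1 m k)
    exact (mul_le_of_le_one_right (h0 k).le h1).trans_lt h2
  have hexp : Real.exp (-(q.sigma ^ 2 * q.theta / q.rho m)) ≤ 1 := by
    have h1 := q.theta_pos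
    have h2 := q.rho_pos m
    rw [Real.exp_le_one_iff, neg_nonpos]
    positivity
  rw [failProb, sub_pos]
  exact mul_lt_one_of_nonneg_of_lt_one_right hexp (Finset.prod_nonneg fun k _ =>
    mul_nonneg (intraFactor_pos hx.1 m k).le (Real.exp_pos _).le) hprod

/-- The hypergeometric values do not depend on `x`; only the intensities do, and linearly. -/
theorem continuousOn_failProb (q : RampingParams M) :
    ContinuousOn q.failProb (stdSimplex ℝ (Fin M)) := by
  refine continuousOn_pi.2 fun m => ?_
  unfold failProb
  refine continuousOn_const.sub (continuousOn_const.mul (continuousOn_finsetProd _ fun k _ => ?_))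
  refine ContinuousOn.mul ?_ ?_
  · have h : ContinuousOn (fun x : Fin M → ℝ => (voronoiShape * q.lam / (voronoiShape * q.lam +
        q.activeIntensity x k * (q.relThreshold m k / (1 + q.relThreshold m k)))) ^ voronoiShape)
        (stdSimplex ℝ (Fin M)) := by
      refine ContinuousOn.rpow_const (continuousOn_const.div ?_ fun x hx => ?_)
        fun x _ => Or.inr voronoiShape_pos.le
      · unfold activeIntensity
        fun_prop
      · have h1 := activeIntensity_nonneg (q := q) hx.1 k
        have h2 := q.relThreshold_pos m k
        have h3 : 0 < voronoiShape * q.lam := mul_pos voronoiShape_pos q.lam_pos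
        positivity
    exact h.congr fun x hx => intraFactor_eq hx.1 m k
  · unfold interFactor activeIntensity
    fun_prop

end RampingParams

/-! ### The ramping chain -/

section Chain

variable {n : ℕ}

/-- Solutions of the recursion are the multiples of the partial products of `c`, which are positive;
the normalisation fixes the multiple. -/
theorem existsUnique_recursion_sum_eq_one (c : Fin n → ℝ) (hc : ∀ j, 0 < c j) :
    ∃ y : Fin (n + 1) → ℝ, (∀ k, 0 < y k) ∧ ∀ x : Fin (n + 1) → ℝ,
      ((∀ j : Fin n, x j.succ = c j * x j.castSucc) ∧ ∑ k, x k = 1) ↔ x = y := by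
  set w : Fin (n + 1) → ℝ := Fin.partialProd c with hw
  have hw0 : w 0 = 1 := Fin.partialProd_zero c
  have hws : ∀ j : Fin n, w j.succ = c j * w j.castSucc := fun j => by
    rw [hw, Fin.partialProd_succ, mul_comm]
  have hwpos : ∀ k, 0 < w k := fun k => by
    induction k using Fin.induction with
    | zero => rw [hw0]; exact one_pos
    | succ j ih => rw [hws]; exact mul_pos (hc j) ih
  have hW : 0 < ∑ k, w k := Finset.sum_pos (fun k _ => hwpos k) Finset.univ_nonempty
  refine ⟨fun k => w k / ∑ k, w k, fun k => div_pos (hwpos k) hW, fun x => ⟨?_, ?_⟩⟩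
  · rintro ⟨h1, h2⟩
    have h3 : ∀ k, x k = x 0 * w k := fun k => by
      induction k using Fin.induction with
      | zero => rw [hw0, mul_one]
      | succ j ih => rw [h1, ih, hws]; ring
    rw [Finset.sum_congr rfl fun k _ => h3 k, ← Finset.mul_sum] at h2
    funext k
    rw [h3 k, eq_div_iff hW.ne', mul_right_comm, h2, one_mul]
  · rintro rfl
    refine ⟨fun j => by dsimp only; rw [hws, mul_div_assoc], ?_⟩
    rw [← Finset.sum_div, div_self hW.ne']

theorem vecMul_rampMatrix_succ (p x : Fin (n + 1) → ℝ) (j : Fin n) :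
    Matrix.vecMul x (rampMatrix p) j.succ = x j.castSucc * p j.castSucc +
      if j.succ = Fin.last n then x j.succ * p j.succ else 0 := by
  -- The last level is split off because a failure there stays put; among the others only level `j`
  -- leads to `j + 1`.
  rw [Matrix.vecMul, dotProduct, Fin.sum_univ_castSucc]
  congr 1
  · rw [Finset.sum_eq_single j]
    · have h := j.2
      simp only [rampMatrix, Fin.val_succ, Fin.val_castSucc]
      rw [if_neg (by omega), if_pos (by omega), zero_add]
    · intro i _ hij
      have h := i.2
      have hij' : (i : ℕ) ≠ j := fun hh => hij (Fin.ext hh)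
      simp only [rampMatrix, Fin.val_succ, Fin.val_castSucc]
      rw [if_neg (by omega), if_neg (by omega)]
      simp
    · simp
  · have h := j.2
    simp only [rampMatrix, Fin.val_succ, Fin.val_last, Fin.ext_iff]
    rw [if_neg (by omega), zero_add]
    by_cases hj : (j : ℕ) + 1 = n
    · have hj' : j.succ = Fin.last n := Fin.ext hj
      rw [if_pos (by omega), if_pos hj, hj']
    · rw [if_neg (by omega), if_neg hj, mul_zero]

theorem sum_rampMatrix (p : Fin (n + 1) → ℝ) (i : Fin (n + 1)) : ∑ j, rampMatrix p i j = 1 := by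
  have h1 : ∀ j : Fin (n + 1), ((j : ℕ) = 0) ↔ j = 0 := fun j => Fin.val_eq_zero_iff
  have h2 : ∀ j : Fin (n + 1), ((j : ℕ) = min ((i : ℕ) + 1) (n + 1 - 1)) ↔
      j = ⟨min ((i : ℕ) + 1) n, by omega⟩ := fun j => by simp [Fin.ext_iff]
  simp only [rampMatrix, Finset.sum_add_distrib, h1, h2, Finset.sum_ite_eq', Finset.mem_univ,
    if_true]
  ring

theorem sum_vecMul_rampMatrix (p x : Fin (n + 1) → ℝ) :
    ∑ j, Matrix.vecMul x (rampMatrix p) j = ∑ i, x i := by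
  simp only [Matrix.vecMul, dotProduct]
  rw [Finset.sum_comm]
  simp_rw [← Finset.mul_sum, sum_rampMatrix, mul_one]

/-- Each equation above the first level is one step of a recursion; at the last level the self-loop
is solved for, hence the division by `1 - p`. The first equation is redundant because the rows of
the matrix sum to 1. -/
theorem solvesStationary_iff {p : Fin (n + 1) → ℝ} (hp : ∀ k, p k < 1) (x : Fin (n + 1) → ℝ) :
    SolvesStationary p x ↔ (∀ j : Fin n, x j.succ =
      p j.castSucc / (if j.succ = Fin.last n then 1 - p j.succ else 1) * x j.castSucc) ∧
      ∑ k, x k = 1 := by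
  have key : ∀ j : Fin n, Matrix.vecMul x (rampMatrix p) j.succ = x j.succ ↔ x j.succ =
      p j.castSucc / (if j.succ = Fin.last n then 1 - p j.succ else 1) * x j.castSucc := fun j => by
    have h := sub_pos.2 (hp j.succ)
    rw [vecMul_rampMatrix_succ]
    split_ifs
    · rw [div_mul_eq_mul_div, eq_div_iff h.ne']
      constructor <;> intro h' <;> linarith
    · rw [div_one, add_zero, mul_comm, eq_comm]
  refine and_congr_left fun _ => ⟨fun h j => (key j).1 (congrFun h _), fun h => ?_⟩
  have hs : ∀ j : Fin n, Matrix.vecMul x (rampMatrix p) j.succ = x j.succ := fun j => (key j).2 (h j)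
  funext k
  refine Fin.cases ?_ hs k
  have := sum_vecMul_rampMatrix p x
  rw [Fin.sum_univ_succ, Fin.sum_univ_succ (f := x), Finset.sum_congr rfl fun j _ => hs j] at this
  linarith

/-- The stationary equations of the ramping chain have exactly one solution, and it is positive. -/
theorem exists_forall_solvesStationary_iff {M : ℕ} (hM : 1 ≤ M) {p : Fin M → ℝ}
    (h0 : ∀ k, 0 < p k) (h1 : ∀ k, p k < 1) :
    ∃ y : Fin M → ℝ, (∀ k, 0 < y k) ∧ ∀ x, SolvesStationary p x ↔ x = y := by
  obtain ⟨n, rfl⟩ := Nat.exists_eq_add_of_le' hM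
  simp_rw [solvesStationary_iff h1]
  refine existsUnique_recursion_sum_eq_one _ fun j => div_pos (h0 _) ?_
  split_ifs
  · exact sub_pos.2 (h1 _)
  · exact one_pos

end Chain

/-! ### The iterative algorithm -/

namespace RampingParams

variable {M : ℕ} {q : RampingParams M} {x : Fin M → ℝ}

theorem exists_forall_solvesStationary_failProb_iff (hM : 1 ≤ M) (hx : x ∈ stdSimplex ℝ (Fin M)) :
    ∃ y : Fin M → ℝ, (∀ k, 0 < y k) ∧ ∀ z, SolvesStationary (q.failProb x) z ↔ z = y :=
  exists_forall_solvesStationary_iff hM (failProb_pos hx) (failProb_lt_one hx.1)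

theorem pos_of_solvesStationary (hM : 1 ≤ M) (hx : x ∈ stdSimplex ℝ (Fin M)) {y : Fin M → ℝ}
    (hy : SolvesStationary (q.failProb x) y) (k : Fin M) : 0 < y k := by
  obtain ⟨z, hz, h⟩ := exists_forall_solvesStationary_failProb_iff (q := q) hM hx
  rw [(h y).1 hy]
  exact hz k

theorem mem_stdSimplex_of_solvesStationary (hM : 1 ≤ M) (hx : x ∈ stdSimplex ℝ (Fin M))
    {y : Fin M → ℝ} (hy : SolvesStationary (q.failProb x) y) : y ∈ stdSimplex ℝ (Fin M) :=
  ⟨fun k => (pos_of_solvesStationary hM hx hy k).le, hy.2⟩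

theorem existsUnique_solvesStationary (hM : 1 ≤ M) (hx : x ∈ stdSimplex ℝ (Fin M)) :
    ∃! y, SolvesStationary (q.failProb x) y := by
  obtain ⟨y, -, h⟩ := exists_forall_solvesStationary_failProb_iff (q := q) hM hx
  exact ⟨y, (h y).2 rfl, fun z hz => (h z).1 hz⟩

theorem IsRun.mem_stdSimplex (hM : 1 ≤ M) {x₀ : Fin M → ℝ} (hx₀ : x₀ ∈ stdSimplex ℝ (Fin M))
    {x : ℕ → Fin M → ℝ} (h : q.IsRun x₀ x) (i : ℕ) : x i ∈ stdSimplex ℝ (Fin M) := by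
  induction i with
  | zero => rw [h.1]; exact hx₀
  | succ i ih => exact mem_stdSimplex_of_solvesStationary hM ih (h.2 i)

theorem existsUnique_isRun (hM : 1 ≤ M) {x₀ : Fin M → ℝ} (hx₀ : x₀ ∈ stdSimplex ℝ (Fin M)) :
    ∃! x : ℕ → Fin M → ℝ, q.IsRun x₀ x := by
  -- The solution map is extended arbitrarily off the simplex; the iterates never leave it.
  choose! T hT hTu using fun (x : Fin M → ℝ) (hx : x ∈ stdSimplex ℝ (Fin M)) =>
    existsUnique_solvesStationary (q := q) hM hx
  have hmem : ∀ i, T^[i] x₀ ∈ stdSimplex ℝ (Fin M) := fun i => by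
    induction i with
    | zero => exact hx₀
    | succ i ih =>
      rw [Function.iterate_succ_apply']
      exact mem_stdSimplex_of_solvesStationary hM ih (hT _ ih)
  refine ⟨fun i => T^[i] x₀, ⟨rfl, fun i => ?_⟩, fun z hz => funext fun i => ?_⟩
  · dsimp only
    rw [Function.iterate_succ_apply']
    exact hT _ (hmem i)
  · induction i with
    | zero => exact hz.1
    | succ i ih =>
      rw [Function.iterate_succ_apply']
      have h := hz.2 i
      rw [ih] at h
      exact hTu _ (hmem i) _ h

/-- The graph of one round of the algorithm. -/
def roundGraph (q : RampingParams M) : Set ((Fin M → ℝ) × (Fin M → ℝ)) :=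
  {z | z ∈ stdSimplex ℝ (Fin M) ×ˢ stdSimplex ℝ (Fin M) ∧ SolvesStationary (q.failProb z.1) z.2}

/-- The stationary equation is continuous in both vectors jointly. A closed graph is all that the
limit and compactness arguments use, so continuity of the solution map is not needed. -/
theorem isClosed_roundGraph (q : RampingParams M) : IsClosed q.roundGraph := by
  set K := stdSimplex ℝ (Fin M) ×ˢ stdSimplex ℝ (Fin M)
  have hK : IsClosed K := (isClosed_stdSimplex ℝ (Fin M)).prod (isClosed_stdSimplex ℝ (Fin M))
  have hr : Continuous (rampMatrix : (Fin M → ℝ) → Matrix (Fin M) (Fin M) ℝ) := by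
    refine continuous_matrix fun i j => ?_
    unfold rampMatrix
    split_ifs <;> fun_prop
  have hc : ContinuousOn (fun z : (Fin M → ℝ) × (Fin M → ℝ) =>
      Matrix.vecMul z.2 (rampMatrix (q.failProb z.1)) - z.2) K := by
    refine ContinuousOn.sub ?_ continuousOn_snd
    have h1 : ContinuousOn (fun z : (Fin M → ℝ) × (Fin M → ℝ) =>
        (z.2, rampMatrix (q.failProb z.1))) K :=
      continuousOn_snd.prodMk (hr.comp_continuousOn
        (q.continuousOn_failProb.comp continuousOn_fst fun z hz => hz.1))
    have h2 : Continuous fun w : (Fin M → ℝ) × Matrix (Fin M) (Fin M) ℝ => Matrix.vecMul w.1 w.2 :=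
      continuous_fst.matrix_vecMul continuous_snd
    exact h2.comp_continuousOn h1
  have h := hc.preimage_isClosed_of_isClosed hK (isClosed_singleton (x := 0))
  convert h using 1
  ext z
  simp only [roundGraph, SolvesStationary, Set.mem_ofPred_eq, Set.mem_inter_iff, Set.mem_preimage,
    Set.mem_singleton_iff, sub_eq_zero]
  exact and_congr_right fun hz => and_iff_left hz.2.2

theorem isSteadyState_iff_mem_roundGraph : q.IsSteadyState x ↔ (x, x) ∈ q.roundGraph := by
  simp [IsSteadyState, roundGraph]

theorem IsRun.mem_roundGraph (hM : 1 ≤ M) {x₀ : Fin M → ℝ} (hx₀ : x₀ ∈ stdSimplex ℝ (Fin M))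
    {x : ℕ → Fin M → ℝ} (h : q.IsRun x₀ x) (i : ℕ) : (x i, x (i + 1)) ∈ q.roundGraph :=
  ⟨⟨h.mem_stdSimplex hM hx₀ i, h.mem_stdSimplex hM hx₀ (i + 1)⟩, h.2 i⟩

/-- Consecutive pairs lie in the closed graph and converge to `(y, y)`. -/
theorem IsRun.isSteadyState_of_tendsto (hM : 1 ≤ M) {x₀ : Fin M → ℝ}
    (hx₀ : x₀ ∈ stdSimplex ℝ (Fin M)) {x : ℕ → Fin M → ℝ} (h : q.IsRun x₀ x) {y : Fin M → ℝ}
    (hy : Filter.Tendsto x Filter.atTop (nhds y)) : q.IsSteadyState y := by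
  rw [isSteadyState_iff_mem_roundGraph]
  exact q.isClosed_roundGraph.mem_of_tendsto
    (hy.prodMk_nhds (hy.comp (Filter.tendsto_add_atTop_nat 1)))
    (Filter.Eventually.of_forall fun i => h.mem_roundGraph hM hx₀ i)

/-- Rounds that change their argument by little end close to a steady state. -/
theorem exists_forall_mem_roundGraph_near_steadyState (q : RampingParams M) {δ : ℝ} (hδ : 0 < δ) :
    ∃ ε₀ > 0, ∀ z ∈ q.roundGraph, dist z.1 z.2 < ε₀ →
      ∃ s, q.IsSteadyState s ∧ ∀ k, |z.2 k - s k| < δ := by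
  -- Pairs whose second entry is δ-far from every steady state. On the compact set `roundGraph ∩ F`
  -- the displacement attains its minimum, which is the tolerance sought.
  set F : Set ((Fin M → ℝ) × (Fin M → ℝ)) :=
    {z | ∀ s, q.IsSteadyState s → ∃ k, δ ≤ |z.2 k - s k|} with hF
  have hFc : IsClosed F := by
    have : F = ⋂ s, ⋂ (_ : q.IsSteadyState s), ⋃ k, {z | δ ≤ |z.2 k - s k|} := by
      ext z; simp [hF]
    rw [this]
    refine isClosed_iInter fun s => isClosed_iInter fun _ => isClosed_iUnion_of_finite fun k => ?_
    exact isClosed_le continuous_const (by fun_prop)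
  have hK : IsCompact (q.roundGraph ∩ F) :=
    ((isCompact_stdSimplex ℝ (Fin M)).prod (isCompact_stdSimplex ℝ (Fin M))).of_isClosed_subset
      (q.isClosed_roundGraph.inter hFc) fun z hz => hz.1.1
  have hfar : ∀ z ∈ q.roundGraph, z ∉ F → ∃ s, q.IsSteadyState s ∧ ∀ k, |z.2 k - s k| < δ := by
    intro z _ hz
    simpa [hF] using hz
  rcases (q.roundGraph ∩ F).eq_empty_or_nonempty with he | hne
  · refine ⟨1, one_pos, fun z hz _ => hfar z hz fun hz' => ?_⟩
    exact (he ▸ ⟨hz, hz'⟩ : z ∈ (∅ : Set _))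
  · obtain ⟨z₀, hz₀, hmin⟩ := hK.exists_isMinOn hne
      (f := fun z => dist z.1 z.2) (by fun_prop)
    refine ⟨dist z₀.1 z₀.2, dist_pos.2 fun heq => ?_, fun z hz hlt => hfar z hz fun hz' =>
      absurd (hmin ⟨hz, hz'⟩) (not_le.2 hlt)⟩
    -- Zero displacement would put the minimiser on the diagonal, making its second entry a steady
    -- state at distance 0 from itself.
    obtain ⟨k, hk⟩ := hz₀.2 z₀.2 (isSteadyState_iff_mem_roundGraph.2 (by
      have := hz₀.1
      rwa [show z₀ = (z₀.2, z₀.2) from Prod.ext heq rfl] at this))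
    simp at hk
    linarith

end RampingParams

end

/-! ### Main theorem -/

theorem theorem2 (M : ℕ) (hM : 1 ≤ M) (q : RampingParams M) :
    -- failure probabilities of the network, for a given vector of state probabilities
    (∀ (x : Fin M → ℝ), x ∈ stdSimplex ℝ (Fin M) →
      ∀ (Ω : Type*) [MeasurableSpace Ω] (P : Measure Ω) [IsProbabilityMeasure P]
        (N : RampingNetwork q x P),
        (∀ m, P.real (N.failAt m) = q.failProb x m) ∧
        (∀ m, 0 < x m → (P[|{ω | N.state ω = m}]).real N.fail = q.failProb x m) ∧
        P.real N.fail = ∑ m, x m * q.failProb x m ∧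
        (SolvesStationary (fun m => P.real (N.failAt m)) x ↔ q.IsSteadyState x)) ∧
    -- the special case `η = 4`
    (q.eta = 4 → ∀ x ∈ stdSimplex ℝ (Fin M), ∀ m,
      q.failProb x m = 1 - Real.exp (-(q.sigma ^ 2 * q.theta / q.rho m)) *
        ∏ k, q.intraFactor x m k *
          Real.exp (-(q.activeIntensity x k / q.lam * √(q.relThreshold m k) *
            Real.arctan √(q.relThreshold m k)))) ∧
    -- one round of the algorithm: the stationary equations have exactly one solution,
    -- and it is a probability vector with positive entries
    (∀ x ∈ stdSimplex ℝ (Fin M),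
      (∀ m, 0 < q.failProb x m ∧ q.failProb x m < 1) ∧
      (∃! y, SolvesStationary (q.failProb x) y) ∧
      ∀ y, SolvesStationary (q.failProb x) y → y ∈ stdSimplex ℝ (Fin M) ∧ ∀ k, 0 < y k) ∧
    -- the algorithm: its iterates are well defined, their limits are steady states, and for a small
    -- tolerance the returned vector is as close as desired to a steady state
    (∀ x₀ ∈ stdSimplex ℝ (Fin M), ∃! x : ℕ → Fin M → ℝ, q.IsRun x₀ x) ∧
    (∀ x₀ ∈ stdSimplex ℝ (Fin M), ∀ (x : ℕ → Fin M → ℝ) (y : Fin M → ℝ), q.IsRun x₀ x →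
      Filter.Tendsto x Filter.atTop (nhds y) → q.IsSteadyState y) ∧
    (∀ δ > 0, ∃ ε₀ > 0, ∀ ε, 0 < ε → ε ≤ ε₀ → ∀ x₀ ∈ stdSimplex ℝ (Fin M), ∀ y,
      q.Returns ε x₀ y → ∃ x, q.IsSteadyState x ∧ ∀ k, |y k - x k| < δ) := by
  refine ⟨fun x hx Ω _ P _ N => ?_, fun h4 x _ m => ?_, fun x hx => ?_, fun x₀ hx₀ => ?_,
    fun x₀ hx₀ x y hrun hy => ?_, fun δ hδ => ?_⟩
  · refine ⟨N.measureReal_failAt hx.1, fun m hm => N.cond_measureReal_fail hx.1 hm,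
      N.measureReal_fail hx.1, ?_⟩
    rw [funext (N.measureReal_failAt hx.1)]
    exact (and_iff_right hx).symm
  · simp_rw [RampingParams.failProb, RampingParams.interFactor_of_eta_eq_four h4]
  · exact ⟨fun m => ⟨RampingParams.failProb_pos hx m, RampingParams.failProb_lt_one hx.1 m⟩,
      RampingParams.existsUnique_solvesStationary hM hx,
      fun y hy => ⟨RampingParams.mem_stdSimplex_of_solvesStationary hM hx hy,
        RampingParams.pos_of_solvesStationary hM hx hy⟩⟩
  · exact RampingParams.existsUnique_isRun hM hx₀
  · exact hrun.isSteadyState_of_tendsto hM hx₀ hy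
  · obtain ⟨ε₀, hε₀, h⟩ := q.exists_forall_mem_roundGraph_near_steadyState hδ
    refine ⟨ε₀, hε₀, fun ε hε hle x₀ hx₀ y hy => ?_⟩
    obtain ⟨x, hrun, i, -, hlt, rfl⟩ := hy
    -- The distance on `Fin M → ℝ` is the maximum of the coordinate distances, which is the stopping
    -- criterion.
    refine h _ (hrun.mem_roundGraph hM hx₀ i) ((dist_pi_lt_iff hε₀).2 fun k => ?_)
    rw [dist_comm, Real.dist_eq]
    exact (hlt k).trans_le hle
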